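/- Let $n,q,d$ be nonnegative integers, let $P\in\mathbb C[X_1,\dots,X_n]$ be a homogeneous polynomial of degree $d$, and let $b\in\mathcal S((\mathbb Z^n)^q)$ be a complex Schwartz sequence, i.e. for every $r\in\mathbb N_0$ the quantity $(1+|l_1|^2+\cdots+|l_q|^2)^r|b(l)|^2$ is bounded over $l=(l_1,\dots,l_q)\in(\mathbb Z^n)^q$. Here $|\cdot|$ is the Euclidean norm, and $dS$ is the surface measure of the unit sphere $S^{n-1}\subset\mathbb R^n$. For $a\in\mathbb R^n$ put $$f_a(s)=\sum_{k\in\mathbb Z^n\setminus\{0\}}\frac{P(k)}{|k|^s}\,e^{2\pi i k\cdot a}.$$ A vector $a\in\mathbb R^n$ is called badly approximable if there are $\delta,c>0$ such that $|m\cdot a-p|\ge c\,|m|^{-\delta}$ for all $m\in\mathbb Z^n\setminus\{0\}$ and $p\in\mathbb Z$. A real $n\times n$ matrix $\Theta$ is called badly approximable if ${}^t\Theta u$ is a badly approximable vector for some $u\in\mathbb Z^n$. For $\varepsilon\in\{-1,0,1\}^q$ let $\mathcal Z=\{l\in(\mathbb Z^n)^q:\sum_{i=1}^q\varepsilon_il_i=0\}$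 and $V=\sum_{l\in\mathcal Z}b(l)$, and put $$g(s)=\sum_{l\in(\mathbb Z^n)^q}b(l)\,f_{\Theta\sum_i\varepsilon_il_i}(s),\qquad g_0(s)=\sum_{l\in(\mathbb Z^n)^q\setminus\mathcal Z}b(l)\,f_{\Theta\sum_i\varepsilon_il_i}(s).$$ The sum of $b$ converges absolutely, and for $\operatorname{Re}s>d+n$ so do the series defining $f_a(s)$, $g(s)$ and $g_0(s)$ (for every $a$, $\Theta$ and $\varepsilon$). Moreover: (i) 1. If $a\in\mathbb Z^n$, then $f_a$ has a meromorphic continuation to $\mathbb C$, holomorphic outside $d+n$. It fails to extend to an entire function if and only if $\int_{S^{n-1}}P\,dS\ne0$, and in that case the continuation has a simple pole at $s=d+n$, with residue $\int_{S^{n-1}}P\,dS$. (i) 2. If $a\in\mathbb R^n\setminus\mathbb Z^n$, then $f_a$ extends to an entire function. (ii) If $\Theta$ is badly approximable, then for every $\varepsilon\in\{-1,0,1\}^q$ the function $g$ extends meromorphically to $\mathbb C$, with $s=d+n$ as the only possible pole. If $V\int_{S^{n-1}}P\,dS\neq0$, then $s=d+n$ is a simple pole of $g$, with residue $V\int_{S^{n-1}}P\,dS$.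 If $V\int_{S^{n-1}}P\,dS=0$, then $g$ extends to an entire function. (iii) If $\Theta$ is badly approximable, then for every $\varepsilon\in\{-1,0,1\}^q$ the function $g_0$ extends to an entire function. -/

import Mathlib

open Filter Topology MeasureTheory

noncomputable section

namespace TwistedSeries

/-- The integer vector `k`, seen as a real vector. -/
def toReal {n : ℕ} (k : Fin n → ℤ) : Fin n → ℝ := fun i => (k i : ℝ)

/-- The Euclidean norm `|k|` of an integer vector. -/
def znorm {n : ℕ} (k : Fin n → ℤ) : ℝ := Real.sqrt (∑ i, (k i : ℝ) ^ 2)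

/-- `b` is a Schwartz sequence on `(ℤⁿ)^q`: for every `r`, the sequence
`(1 + |l₁|² + ⋯ + |l_q|²)^r |b(l)|²` is bounded. -/
def IsSchwartzSeq {n q : ℕ} (b : (Fin q → Fin n → ℤ) → ℂ) : Prop :=
  ∀ r : ℕ, ∃ C : ℝ, ∀ l : Fin q → Fin n → ℤ,
    (1 + ∑ i, znorm (l i) ^ 2) ^ r * ‖b l‖ ^ 2 ≤ C

/-- `a` is `δ`-badly approximable: there is `c > 0` with `|q·a - m| ≥ c |q|^(-δ)` for all nonzero
`q ∈ ℤⁿ` and all `m ∈ ℤ`. -/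
def IsBadlyApproximableWith {n : ℕ} (δ : ℝ) (a : Fin n → ℝ) : Prop :=
  ∃ c : ℝ, 0 < c ∧ ∀ q : Fin n → ℤ, q ≠ 0 → ∀ m : ℤ,
    c * znorm q ^ (-δ) ≤ |toReal q ⬝ᵥ a - (m : ℝ)|

/-- `a` is badly approximable: it is `δ`-badly approximable for some `δ > 0`. -/
def IsBadlyApproximable {n : ℕ} (a : Fin n → ℝ) : Prop :=
  ∃ δ : ℝ, 0 < δ ∧ IsBadlyApproximableWith δ a

/-- The matrix `Θ` is badly approximable: `ᵗΘ u` is a badly approximable vector for some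
`u ∈ ℤⁿ`. -/
def IsBadlyApproximableMatrix {n : ℕ} (Θ : Matrix (Fin n) (Fin n) ℝ) : Prop :=
  ∃ u : Fin n → ℤ, IsBadlyApproximable (Θ.transpose.mulVec (toReal u))

/-- The term `P(k) |k|^(-s) e^{2πi k·a}`. -/
def term {n : ℕ} (P : MvPolynomial (Fin n) ℂ) (a : Fin n → ℝ) (s : ℂ) (k : Fin n → ℤ) : ℂ :=
  MvPolynomial.eval (fun i => (k i : ℂ)) P * (znorm k : ℂ) ^ (-s) *
    Complex.exp (2 * Real.pi * Complex.I * ((toReal k ⬝ᵥ a : ℝ) : ℂ))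

/-- The series `f_a(s)`, the sum of `P(k) |k|^(-s) e^{2πi k·a}` over nonzero `k ∈ ℤⁿ`. -/
def twistedSum {n : ℕ} (P : MvPolynomial (Fin n) ℂ) (a : Fin n → ℝ) (s : ℂ) : ℂ :=
  ∑' k : {k : Fin n → ℤ // k ≠ 0}, term P a s k

/-- The integral of `P` over the Euclidean unit sphere of `ℝⁿ` for its surface measure. -/
def sphereIntegral {n : ℕ} (P : MvPolynomial (Fin n) ℂ) : ℂ :=
  ∫ u : Metric.sphere (0 : EuclideanSpace ℝ (Fin n)) 1,
    MvPolynomial.eval (fun i => (((u : EuclideanSpace ℝ (Fin n)) i : ℝ) : ℂ)) P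
      ∂((volume : Measure (EuclideanSpace ℝ (Fin n))).toSphere)

/-- The combination `∑ᵢ εᵢ lᵢ ∈ ℤⁿ`. -/
def combo {n q : ℕ} (ε : Fin q → ℤ) (l : Fin q → Fin n → ℤ) : Fin n → ℤ :=
  ∑ i, ε i • l i

/-- The resonant set `𝒵 = {l : ∑ᵢ εᵢ lᵢ = 0}`. -/
def resonantSet {n q : ℕ} (ε : Fin q → ℤ) : Set (Fin q → Fin n → ℤ) :=
  {l | combo ε l = 0}

/-- `V`, the sum of `b` over the resonant set. -/
def resonantSum {n q : ℕ} (ε : Fin q → ℤ) (b : (Fin q → Fin n → ℤ) → ℂ) : ℂ :=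
  ∑' l : (resonantSet ε : Set (Fin q → Fin n → ℤ)), b l

/-- The term `b(l) f_{Θ ∑ᵢ εᵢ lᵢ}(s)`. -/
def averagedTerm {n q : ℕ} (P : MvPolynomial (Fin n) ℂ) (Θ : Matrix (Fin n) (Fin n) ℝ)
    (ε : Fin q → ℤ) (b : (Fin q → Fin n → ℤ) → ℂ) (s : ℂ) (l : Fin q → Fin n → ℤ) : ℂ :=
  b l * twistedSum P (Θ.mulVec (toReal (combo ε l))) s

/-- `g(s)`, the sum of `b(l) f_{Θ ∑ᵢ εᵢ lᵢ}(s)` over all `l ∈ (ℤⁿ)^q`. -/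
def averagedSum {n q : ℕ} (P : MvPolynomial (Fin n) ℂ) (Θ : Matrix (Fin n) (Fin n) ℝ)
    (ε : Fin q → ℤ) (b : (Fin q → Fin n → ℤ) → ℂ) (s : ℂ) : ℂ :=
  ∑' l : Fin q → Fin n → ℤ, averagedTerm P Θ ε b s l

/-- `g₀(s)`, the sum of `b(l) f_{Θ ∑ᵢ εᵢ lᵢ}(s)` over the non-resonant `l`. -/
def offResonantSum {n q : ℕ} (P : MvPolynomial (Fin n) ℂ) (Θ : Matrix (Fin n) (Fin n) ℝ)
    (ε : Fin q → ℤ) (b : (Fin q → Fin n → ℤ) → ℂ) (s : ℂ) : ℂ :=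
  ∑' l : ((resonantSet ε)ᶜ : Set (Fin q → Fin n → ℤ)), averagedTerm P Θ ε b s l

/-- `F` is a meromorphic continuation to `ℂ` of the function `f`, given on `Re s > σ`. -/
structure IsMeromorphicContinuation (σ : ℝ) (f F : ℂ → ℂ) : Prop where
  meromorphic : ∀ z : ℂ, MeromorphicAt F z
  eq_of_lt_re : ∀ s : ℂ, σ < s.re → F s = f s

/-- `f`, given on `Re s > σ`, extends to an entire function. -/
def ExtendsToEntire (σ : ℝ) (f : ℂ → ℂ) : Prop :=
  ∃ F : ℂ → ℂ, Differentiable ℂ F ∧ ∀ s : ℂ, σ < s.re → F s = f s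

/-- `F` has a simple pole at `z`, with residue `R`. -/
def HasSimplePoleWithResidue (F : ℂ → ℂ) (z R : ℂ) : Prop :=
  meromorphicOrderAt F z = -1 ∧ Tendsto (fun s => (s - z) * F s) (𝓝[≠] z) (𝓝 R)

end TwistedSeries

end

/-!
Write `w = d + n`. The proof uses neither theta functions nor Poisson summation.

**Nontrivial twists.** Taking the unit difference of the summand `P(k) |k| ^ (-s)` in direction `i`
multiplies the sum of its products with `e^{2πi k·a}` by `e^{-2πi aᵢ} - 1` (`diffSum_succ`).
Along a line, `P(x) |x| ^ (-s)` is holomorphic on a disc of radius proportional to `|x|`, so by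
Cauchy's estimate each difference gains one power of `|x|`
(`exists_norm_fwdDiff_iter_cutTerm_le`). Hence `N` differences make the series converge for
`Re s > w - N`, and if `aᵢ` is not an integer one may divide by the `N`-th power of the factor. This
gives the entire continuation `contSum`, with a bound that depends on `a` only through a negative
power of the factor (`exists_norm_contSum_le`).

**The trivial twist.** The sum of the twisted series over the `m`-torsion points `c / m` of
`ℝⁿ / ℤⁿ` picks out the multiples of `m`, so it equals `m ^ (w - s) f₀(s)`
(`sum_twistedSum_torsionPoint`). All its terms except the one with `c = 0` are entire. Therefore
`(m ^ (w - s) - 1) f₀(s)` is entire; with `m = 2` and `m = 3`, whose factors vanish simultaneously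
only at `w`, where both zeros are simple, this leaves at most a simple pole at `w`
(`hasPolarForm_of_cpow_mul`). For real `t` decreasing to `w`, the sum `f₀(t)` differs by a bounded
amount from the integral of `P(x) |x| ^ (-t)` over `|x| ≥ 1`, again because one difference gains one
power of `|x|` (`exists_norm_twistedSum_zero_sub_le`). In polar coordinates that integral is the
sphere integral of `P` divided by `t - w`, which identifies the residue
(`hasPolarForm_twistedSum_zero`).

**Averages.** If `Θ` is badly approximable and `m ≠ 0`, then some coordinate of `Θ m` has distance
at least a negative power of `|m|` to the integers
(`IsBadlyApproximableMatrix.exists_le_norm_kappa`). The continuations of the off-resonant terms then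
grow at most polynomially in `l`, locally uniformly in `s`, and the decay of `b` makes their sum
entire (`extendsToEntire_offResonantSum`). The resonant terms contribute `V f₀`.
-/

namespace TwistedSeries

open Metric

/-! ### Finite differences of holomorphic functions -/

/-- Cauchy's estimate for finite differences: an `N`-fold unit difference of a function that is
holomorphic and bounded by `A` on a disc is at most `A / ρ ^ N` on the concentric disc whose radius
is smaller by `2 N ρ`. Each difference costs a factor `ρ⁻¹`, since it is bounded by the derivative
on a disc smaller by `ρ`. -/
lemma norm_fwdDiff_iter_le_of_differentiableOn_ball {ρ : ℝ} (hρ : 1 ≤ ρ) (N : ℕ) :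
    ∀ {R A : ℝ} {g : ℂ → ℂ}, DifferentiableOn ℂ g (ball 0 R) →
      (∀ z ∈ ball (0 : ℂ) R, ‖g z‖ ≤ A) →
      ∀ z ∈ ball (0 : ℂ) (R - 2 * N * ρ), ‖(fwdDiff (1 : ℂ))^[N] g z‖ ≤ A / ρ ^ N := by
  induction N with
  | zero =>
    intro R A g _ hA z hz
    simpa using hA z (by simpa using hz)
  | succ N ih =>
    intro R A g hg hA z hz
    have hρ0 : 0 < ρ := by linarith
    have hdiff : ∀ y ∈ ball (0 : ℂ) (R - ρ), DifferentiableAt ℂ g y := fun y hy =>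
      hg.differentiableAt (isOpen_ball.mem_nhds (ball_subset_ball (by linarith) hy))
    have hderiv : ∀ y ∈ ball (0 : ℂ) (R - ρ), ‖deriv g y‖ ≤ A / ρ := by
      intro y hy
      have hsub : closedBall y ρ ⊆ ball (0 : ℂ) R := by
        intro t ht
        rw [mem_ball_zero_iff] at hy ⊢
        rw [mem_closedBall_iff_norm] at ht
        have := norm_add_le (t - y) y
        rw [sub_add_cancel] at this
        linarith
      refine Complex.norm_deriv_le_of_forall_mem_sphere_norm_le hρ0 ?_
        fun t ht => hA t (hsub (sphere_subset_closedBall ht))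
      exact (hg.mono hsub).diffContOnCl_ball subset_rfl
    have hshift : ∀ y ∈ ball (0 : ℂ) (R - 2 * ρ), y + 1 ∈ ball (0 : ℂ) (R - ρ) := by
      intro y hy
      rw [mem_ball_zero_iff] at hy ⊢
      have := norm_add_le y 1
      rw [norm_one] at this
      linarith
    have hsub2 : ball (0 : ℂ) (R - 2 * ρ) ⊆ ball 0 (R - ρ) := ball_subset_ball (by linarith)
    rw [Function.iterate_succ_apply, pow_succ', ← div_div]
    refine ih (R := R - 2 * ρ) ?_ ?_ z ?_
    · intro y hy
      refine DifferentiableAt.differentiableWithinAt ?_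
      exact ((hdiff _ (hshift y hy)).comp y (by fun_prop)).sub (hdiff y (hsub2 hy))
    · intro y hy
      have := (convex_ball (0 : ℂ) (R - ρ)).norm_image_sub_le_of_norm_deriv_le hdiff hderiv
        (hsub2 hy) (hshift y hy)
      simpa [fwdDiff] using this
    · convert hz using 2
      push_cast
      ring

/-! ### The summand as a function on `ℝⁿ` -/

/-- The function `P(x) |x| ^ (-s)` on `ℝⁿ`, cut off to `0` inside the Euclidean unit ball, with
`|x|` the Euclidean norm. The cut-off changes no value at a nonzero integer point, and it removes
the origin from every sum over `ℤⁿ`. -/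
noncomputable def cutTerm {n : ℕ} (P : MvPolynomial (Fin n) ℂ) (s : ℂ) (x : Fin n → ℝ) : ℂ :=
  if 1 ≤ ∑ i, x i ^ 2 then
    MvPolynomial.eval (fun i => (x i : ℂ)) P * ((∑ i, x i ^ 2 : ℝ) : ℂ) ^ (-s / 2)
  else 0

lemma sq_norm_le_sum_sq {n : ℕ} (x : Fin n → ℝ) : ‖x‖ ^ 2 ≤ ∑ i, x i ^ 2 := by
  have h : ‖x‖ ≤ √(∑ i, x i ^ 2) := by
    rw [pi_norm_le_iff_of_nonneg (Real.sqrt_nonneg _)]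
    intro i
    apply Real.le_sqrt_of_sq_le
    rw [Real.norm_eq_abs, sq_abs]
    exact Finset.single_le_sum (f := fun i => x i ^ 2) (fun j _ => sq_nonneg (x j))
      (Finset.mem_univ i)
  calc ‖x‖ ^ 2 ≤ √(∑ i, x i ^ 2) ^ 2 := by gcongr
    _ = _ := Real.sq_sqrt (by positivity)

lemma sum_sq_le {n : ℕ} (x : Fin n → ℝ) : ∑ i, x i ^ 2 ≤ n * ‖x‖ ^ 2 := by
  calc ∑ i, x i ^ 2 ≤ ∑ _i : Fin n, ‖x‖ ^ 2 := by
        refine Finset.sum_le_sum fun i _ => ?_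
        rw [← sq_abs]
        exact pow_le_pow_left₀ (abs_nonneg _) (norm_le_pi_norm x i) 2
    _ = _ := by simp

lemma sum_eq_of_mem_support {n d : ℕ} {P : MvPolynomial (Fin n) ℂ} (hP : P.IsHomogeneous d)
    {m : Fin n →₀ ℕ} (hm : m ∈ P.support) : ∑ i, m i = d := by
  rw [← Finsupp.degree_eq_sum, Finsupp.degree_eq_weight_one]
  exact hP (MvPolynomial.mem_support_iff.1 hm)

lemma exists_norm_eval_le {n d : ℕ} {P : MvPolynomial (Fin n) ℂ} (hP : P.IsHomogeneous d) :
    ∃ C : ℝ, 0 ≤ C ∧ ∀ y : Fin n → ℂ, ‖MvPolynomial.eval y P‖ ≤ C * ‖y‖ ^ d := by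
  refine ⟨∑ m ∈ P.support, ‖P.coeff m‖, by positivity, fun y => ?_⟩
  rw [MvPolynomial.eval_eq', Finset.sum_mul]
  refine (norm_sum_le _ _).trans (Finset.sum_le_sum fun m hm => ?_)
  rw [norm_mul]
  gcongr
  rw [norm_prod, ← sum_eq_of_mem_support hP hm, ← Finset.prod_pow_eq_pow_sum]
  refine Finset.prod_le_prod (fun i _ => norm_nonneg _) fun i _ => ?_
  rw [norm_pow]
  gcongr
  exact norm_le_pi_norm y i

lemma rpow_le_of_mem_Icc {B Y t p : ℝ} (hB : 1 ≤ B) (hY : 0 < Y) (h1 : B⁻¹ * Y ≤ t)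
    (h2 : t ≤ B * Y) : t ^ p ≤ B ^ |p| * Y ^ p := by
  have hB0 : 0 < B := by linarith
  rcases le_total 0 p with hp | hp
  · rw [abs_of_nonneg hp, ← Real.mul_rpow hB0.le hY.le]
    exact Real.rpow_le_rpow (le_trans (by positivity) h1) h2 hp
  · rw [abs_of_nonpos hp, Real.rpow_neg hB0.le, ← Real.inv_rpow hB0.le,
      ← Real.mul_rpow (by positivity) hY.le]
    exact Real.rpow_le_rpow_of_nonpos (by positivity) h1 hp

/-- The complex polynomial `∑ (xᵢ + z vᵢ)²` stays within half of its value at `z = 0`, as long as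
`|z|` is small compared to `x`. -/
lemma norm_sum_sq_line_sub_le {n : ℕ} (hn : 0 < n) {x v : Fin n → ℝ} (hv : ‖v‖ ≤ 1) {z : ℂ}
    (hz : ‖z‖ ≤ ‖x‖ / (8 * n)) :
    ‖(∑ i, ((x i : ℂ) + z * v i) ^ 2) - ((∑ i, x i ^ 2 : ℝ) : ℂ)‖ ≤ ‖x‖ ^ 2 / 2 := by
  have hn' : (1 : ℝ) ≤ n := by exact_mod_cast hn
  have hX := norm_nonneg x
  have h8 : ‖x‖ / (8 * n) * n = ‖x‖ / 8 := by field_simp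
  have hle : ‖x‖ / (8 * n) ≤ ‖x‖ := div_le_self hX (by linarith)
  push_cast
  rw [← Finset.sum_sub_distrib]
  calc ‖∑ i, (((x i : ℂ) + z * v i) ^ 2 - (x i : ℂ) ^ 2)‖
      ≤ ∑ _i : Fin n, (‖x‖ / (8 * n) * (3 * ‖x‖)) := by
        refine (norm_sum_le _ _).trans (Finset.sum_le_sum fun i _ => ?_)
        have e : ((x i : ℂ) + z * v i) ^ 2 - (x i : ℂ) ^ 2 = z * v i * (2 * x i + z * v i) := by
          ring
        have hvi : ‖(v i : ℂ)‖ ≤ 1 := by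
          rw [Complex.norm_real]
          exact (norm_le_pi_norm v i).trans hv
        have hxi : ‖(x i : ℂ)‖ ≤ ‖x‖ := by
          rw [Complex.norm_real]
          exact norm_le_pi_norm x i
        have hzv : ‖z * v i‖ ≤ ‖x‖ / (8 * n) := by
          rw [norm_mul]
          exact (mul_le_of_le_one_right (norm_nonneg z) hvi).trans hz
        have hsum : ‖2 * (x i : ℂ) + z * v i‖ ≤ 3 * ‖x‖ := by
          refine (norm_add_le _ _).trans ?_
          rw [norm_mul, Complex.norm_ofNat]
          linarith
        rw [e, norm_mul]
        exact mul_le_mul hzv hsum (norm_nonneg _) (by positivity)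
    _ = (‖x‖ / (8 * n) * n) * (3 * ‖x‖) := by
        rw [Finset.sum_const, Finset.card_univ, Fintype.card_fin, nsmul_eq_mul]
        ring
    _ ≤ ‖x‖ ^ 2 / 2 := by
        rw [h8]
        nlinarith [sq_nonneg ‖x‖]

/-- Differences of `P(x) |x| ^ (-s)` gain one power of `|x|` at each step. Along a line
`z ↦ x + z v` this function is holomorphic on a disc of radius proportional to `|x|`, with the same
size there as at `x`. -/
lemma exists_norm_fwdDiff_iter_cutTerm_le {n d : ℕ} {P : MvPolynomial (Fin n) ℂ}
    (hP : P.IsHomogeneous d) (N : ℕ) (M : ℝ) :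
    ∃ C R : ℝ, 0 ≤ C ∧ 1 ≤ R ∧ ∀ s : ℂ, ‖s‖ ≤ M → ∀ x v : Fin n → ℝ, ‖v‖ ≤ 1 → R ≤ ‖x‖ →
      ‖(fwdDiff v)^[N] (cutTerm P s) x‖ ≤ C * ‖x‖ ^ ((d : ℝ) - N - s.re) := by
  rcases Nat.eq_zero_or_pos n with rfl | hn
  · refine ⟨0, 1, le_rfl, le_rfl, fun s _ x v _ hx => ?_⟩
    have : ‖x‖ = 0 := by rw [Subsingleton.elim x 0, norm_zero]
    linarith
  have hn' : (1 : ℝ) ≤ n := by exact_mod_cast hn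
  obtain ⟨CP, hCP, hPle⟩ := exists_norm_eval_le hP
  set K : ℝ := CP * 2 ^ d * ((2 * n : ℝ) ^ M * Real.exp (Real.pi * M)) with hK
  refine ⟨K * (32 * n * (N + 1)) ^ N, 32 * n * (N + 1), by positivity, ?_, ?_⟩
  · nlinarith [(Nat.cast_nonneg N : (0 : ℝ) ≤ N)]
  intro s hs x v hv hx
  have hM : 0 ≤ M := (norm_nonneg s).trans hs
  set X := ‖x‖ with hXdef
  have hN0 : (0 : ℝ) ≤ N := Nat.cast_nonneg N
  have hX32 : 32 ≤ X := by nlinarith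
  have hX0 : 0 < X := by linarith
  set S : ℝ := ∑ i, x i ^ 2 with hS
  have hS1 : X ^ 2 ≤ S := sq_norm_le_sum_sq x
  have hS2 : S ≤ n * X ^ 2 := sum_sq_le x
  -- `R` is a radius of holomorphy, and `ρ` is small enough for `N` steps of size `2 ρ` to use at
  -- most half of it; the lower bound on `‖x‖` is what makes `ρ ≥ 1`
  set R := X / (8 * n) with hR
  set ρ := X / (32 * n * (N + 1)) with hρdef
  have hρ : 1 ≤ ρ := by
    rw [hρdef, one_le_div (by positivity)]
    exact hx
  have hRρ : R = 4 * (N + 1) * ρ := by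
    rw [hR, hρdef]
    field_simp
    norm_num
  set W : ℂ → ℂ := fun z => ∑ i, ((x i : ℂ) + z * v i) ^ 2 with hW
  set g : ℂ → ℂ := fun z =>
    MvPolynomial.eval (fun i => (x i : ℂ) + z * v i) P * W z ^ (-s / 2) with hg
  have hWs : ∀ z : ℂ, ‖z‖ ≤ R → ‖W z - (S : ℂ)‖ ≤ X ^ 2 / 2 := fun z hz =>
    norm_sum_sq_line_sub_le hn hv hz
  -- the base of the power stays in the right half plane, away from the branch cut
  have hWre : ∀ z : ℂ, ‖z‖ ≤ R → X ^ 2 / 2 ≤ (W z).re := by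
    intro z hz
    have h1 := (Complex.abs_re_le_norm _).trans (hWs z hz)
    rw [Complex.sub_re, Complex.ofReal_re, abs_le] at h1
    linarith [h1.1]
  have hWn : ∀ z : ℂ, ‖z‖ ≤ R → ‖W z‖ ≤ 2 * n * X ^ 2 := by
    intro z hz
    have h1 : ‖W z‖ ≤ ‖W z - (S : ℂ)‖ + ‖(S : ℂ)‖ := by
      simpa using norm_add_le (W z - (S : ℂ)) S
    have h2 : ‖(S : ℂ)‖ = S := by
      rw [Complex.norm_real, Real.norm_of_nonneg (by positivity)]
    have := hWs z hz
    nlinarith [sq_nonneg X]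
  have hgdiff : DifferentiableOn ℂ g (ball 0 R) := by
    intro z hz
    rw [mem_ball_zero_iff] at hz
    refine DifferentiableAt.differentiableWithinAt ?_
    have h1 : DifferentiableAt ℂ W z := by
      rw [hW]; fun_prop
    have hslit : W z ∈ Complex.slitPlane := by
      left
      have := hWre z hz.le
      have : 0 < X ^ 2 / 2 := by positivity
      linarith
    have h2 : DifferentiableAt ℂ
        (fun z : ℂ => MvPolynomial.eval (fun i => (x i : ℂ) + z * v i) P) z := by
      simp only [MvPolynomial.eval_eq']
      fun_prop
    exact h2.mul (h1.cpow_const hslit)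
  have hgle : ∀ z ∈ ball (0 : ℂ) R, ‖g z‖ ≤ K * X ^ ((d : ℝ) - s.re) := by
    intro z hz
    rw [mem_ball_zero_iff] at hz
    have hRX : R ≤ X := div_le_self hX0.le (by linarith)
    have hy : ‖fun i => (x i : ℂ) + z * v i‖ ≤ 2 * X := by
      rw [pi_norm_le_iff_of_nonneg (by positivity)]
      intro i
      have hvi : ‖(v i : ℂ)‖ ≤ 1 := by
        rw [Complex.norm_real]
        exact (norm_le_pi_norm v i).trans hv
      have hxi : ‖(x i : ℂ)‖ ≤ X := by
        rw [Complex.norm_real]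
        exact norm_le_pi_norm x i
      refine (norm_add_le _ _).trans ?_
      rw [norm_mul]
      have := mul_le_of_le_one_right (norm_nonneg z) hvi
      linarith
    have h1 : ‖MvPolynomial.eval (fun i => (x i : ℂ) + z * v i) P‖ ≤ CP * (2 * X) ^ d :=
      (hPle _).trans (by gcongr)
    have hW0 : X ^ 2 / 2 ≤ ‖W z‖ := (hWre z hz.le).trans (Complex.re_le_norm _)
    have h2 : ‖W z ^ (-s / 2)‖ ≤ (2 * n : ℝ) ^ M * X ^ (-s.re) * Real.exp (Real.pi * M) := by
      have hre : (-s / 2).re = -s.re / 2 := by simp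
      have him : (-s / 2).im = -s.im / 2 := by simp
      refine (Complex.norm_cpow_le _ _).trans ?_
      rw [hre, him, div_eq_mul_inv, ← Real.exp_neg]
      have habs := (Complex.abs_re_le_norm s).trans hs
      have habs' := (Complex.abs_im_le_norm s).trans hs
      refine mul_le_mul ?_ ?_ (Real.exp_pos _).le (by positivity)
      · have hb : ‖W z‖ ^ (-s.re / 2) ≤ (2 * n : ℝ) ^ |-s.re / 2| * (X ^ 2) ^ (-s.re / 2) := by
          refine rpow_le_of_mem_Icc (by linarith) (by positivity) ?_ (hWn z hz.le)
          refine le_trans ?_ hW0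
          rw [div_eq_inv_mul]
          gcongr
          linarith
        refine hb.trans ?_
        have e : (X ^ 2) ^ (-s.re / 2) = X ^ (-s.re) := by
          rw [← Real.rpow_natCast, ← Real.rpow_mul hX0.le]
          congr 1
          push_cast
          ring
        rw [e]
        gcongr
        · linarith
        · rw [abs_div, abs_neg, abs_two]
          linarith [abs_nonneg s.re]
      · gcongr
        have harg := Complex.abs_arg_le_pi (W z)
        calc -((W z).arg * (-s.im / 2)) ≤ |(W z).arg * (s.im / 2)| := by
              rw [show -((W z).arg * (-s.im / 2)) = (W z).arg * (s.im / 2) by ring]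
              exact le_abs_self _
          _ = |(W z).arg| * (|s.im| / 2) := by rw [abs_mul, abs_div, abs_two]
          _ ≤ Real.pi * M := by
              refine mul_le_mul harg ?_ (by positivity) Real.pi_pos.le
              linarith [abs_nonneg s.im]
    calc ‖g z‖ = _ := norm_mul _ _
      _ ≤ CP * (2 * X) ^ d * ((2 * n : ℝ) ^ M * X ^ (-s.re) * Real.exp (Real.pi * M)) :=
          mul_le_mul h1 h2 (norm_nonneg _) (by positivity)
      _ = K * (X ^ d * X ^ (-s.re)) := by rw [hK, mul_pow]; ring
      _ = _ := by
          rw [← Real.rpow_natCast X d, ← Real.rpow_add hX0]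
          rfl
  have key := norm_fwdDiff_iter_le_of_differentiableOn_ball hρ N hgdiff hgle 0 (by
    rw [mem_ball_zero_iff, norm_zero, hRρ]
    nlinarith)
  have hvals : ∀ j ∈ Finset.range (N + 1), cutTerm P s (x + j • v) = g (0 + j • (1 : ℂ)) := by
    intro j hj
    have hjN : (j : ℝ) ≤ N := by exact_mod_cast Nat.lt_succ_iff.1 (Finset.mem_range.1 hj)
    have hjR : ‖(j : ℂ)‖ ≤ R := by
      rw [Complex.norm_natCast, hRρ]
      nlinarith
    have hWj : W j = ((∑ i, (x + j • v) i ^ 2 : ℝ) : ℂ) := by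
      simp [hW]
    have hge : 1 ≤ ∑ i, (x + j • v) i ^ 2 := by
      have := hWre j hjR
      rw [hWj, Complex.ofReal_re] at this
      nlinarith
    rw [cutTerm, if_pos hge, zero_add, nsmul_one, hg]
    simp only [hWj]
    congr 2
    simp
  have hΔ : (fwdDiff v)^[N] (cutTerm P s) x = (fwdDiff (1 : ℂ))^[N] g 0 := by
    rw [fwdDiff_iter_eq_sum_shift, fwdDiff_iter_eq_sum_shift]
    exact Finset.sum_congr rfl fun j hj => by rw [hvals j hj]
  rw [hΔ]
  refine key.trans (le_of_eq ?_)
  have e : X ^ ((d : ℝ) - N - s.re) = X ^ ((d : ℝ) - s.re) / X ^ N := by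
    rw [← Real.rpow_natCast X N, ← Real.rpow_sub hX0]
    congr 1
    ring
  rw [e, hρdef, div_pow]
  field_simp

/-! ### Sums over lattices -/

lemma summable_pi_prod {α : Type*} {g : α → ℝ} (hg0 : ∀ x, 0 ≤ g x) (hg : Summable g) (n : ℕ) :
    Summable fun k : Fin n → α => ∏ i, g (k i) := by
  induction n with
  | zero => exact (hasSum_fintype _).summable
  | succ n ih =>
    rw [← (Fin.consEquiv fun _ : Fin (n + 1) => α).summable_iff]
    have := hg.mul_of_nonneg ih hg0 fun k => Finset.prod_nonneg fun i _ => hg0 _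
    refine this.congr fun x => ?_
    simp [Fin.prod_univ_succ]

lemma one_add_norm_rpow_le_prod {α : Type*} [SeminormedAddCommGroup α] {n : ℕ} (hn : 0 < n)
    {p : ℝ} (hp : p ≤ 0) (k : Fin n → α) :
    (1 + ‖k‖) ^ p ≤ ∏ i, (1 + ‖k i‖) ^ (p / n) := by
  have hn' : (0 : ℝ) < n := by exact_mod_cast hn
  calc (1 + ‖k‖) ^ p = ∏ _i : Fin n, (1 + ‖k‖) ^ (p / n) := by
        rw [Finset.prod_const, Finset.card_univ, Fintype.card_fin, ← Real.rpow_mul_natCast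
          (by positivity), div_mul_cancel₀ _ hn'.ne']
    _ ≤ _ := by
        refine Finset.prod_le_prod (fun i _ => by positivity) fun i _ => ?_
        refine Real.rpow_le_rpow_of_nonpos (by positivity) ?_ (div_nonpos_of_nonpos_of_nonneg hp
          hn'.le)
        gcongr
        exact norm_le_pi_norm k i

lemma summable_int_one_add_norm_rpow {p : ℝ} (hp : p < -1) :
    Summable fun k : ℤ => (1 + ‖k‖) ^ p := by
  have h := Real.summable_abs_int_rpow (b := -p) (by linarith)
  rw [neg_neg] at h
  refine Summable.of_norm_bounded_eventually h ?_
  filter_upwards [(Set.finite_singleton (0 : ℤ)).compl_mem_cofinite] with k hk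
  have hk0 : (0 : ℝ) < |(k : ℝ)| := by
    rw [abs_pos]
    exact_mod_cast hk
  rw [Real.norm_of_nonneg (by positivity), Int.norm_eq_abs]
  exact Real.rpow_le_rpow_of_nonpos hk0 (by linarith) (by linarith)

/-- The exponent `-n` is sharp; the sum is dominated by a product of `n` one-dimensional sums. -/
lemma summable_one_add_norm_rpow {n : ℕ} {p : ℝ} (hp : p < -n) :
    Summable fun k : Fin n → ℤ => (1 + ‖k‖) ^ p := by
  rcases Nat.eq_zero_or_pos n with rfl | hn
  · exact (hasSum_fintype _).summable
  have hn' : (0 : ℝ) < n := by exact_mod_cast hn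
  refine Summable.of_nonneg_of_le (fun k => by positivity)
    (one_add_norm_rpow_le_prod hn (by linarith)) ?_
  refine summable_pi_prod (g := fun k : ℤ => (1 + ‖k‖) ^ (p / n)) (fun k => by positivity) ?_ n
  refine summable_int_one_add_norm_rpow ?_
  rw [div_lt_iff₀ hn']
  linarith

lemma norm_toReal {n : ℕ} (k : Fin n → ℤ) : ‖toReal k‖ = ‖k‖ := by
  refine le_antisymm ?_ ?_
  · refine (pi_norm_le_iff_of_nonneg (norm_nonneg _)).2 fun i => ?_
    refine le_trans (le_of_eq ?_) (norm_le_pi_norm k i)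
    rw [toReal, Int.norm_eq_abs, Real.norm_eq_abs]
  · refine (pi_norm_le_iff_of_nonneg (norm_nonneg _)).2 fun i => ?_
    refine le_trans (le_of_eq ?_) (norm_le_pi_norm (toReal k) i)
    rw [toReal, Int.norm_eq_abs, Real.norm_eq_abs]

lemma toReal_zero {n : ℕ} : toReal (0 : Fin n → ℤ) = 0 := by
  ext i
  simp [toReal]

lemma toReal_add {n : ℕ} (k l : Fin n → ℤ) : toReal (k + l) = toReal k + toReal l := by
  ext i
  simp [toReal]

/-- The character `e^{2πi k·a}` of `ℤⁿ`. -/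
noncomputable def char {n : ℕ} (a : Fin n → ℝ) (k : Fin n → ℤ) : ℂ :=
  Complex.exp (2 * Real.pi * Complex.I * ((toReal k ⬝ᵥ a : ℝ) : ℂ))

lemma char_add {n : ℕ} (a : Fin n → ℝ) (k l : Fin n → ℤ) :
    char a (k + l) = char a k * char a l := by
  rw [char, char, char, ← Complex.exp_add, toReal_add, add_dotProduct]
  push_cast
  ring_nf

lemma norm_char {n : ℕ} (a : Fin n → ℝ) (k : Fin n → ℤ) : ‖char a k‖ = 1 := by
  rw [char, show (2 * Real.pi * Complex.I * ((toReal k ⬝ᵥ a : ℝ) : ℂ))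
    = ((2 * Real.pi * (toReal k ⬝ᵥ a) : ℝ) : ℂ) * Complex.I by push_cast; ring]
  exact Complex.norm_exp_ofReal_mul_I _

lemma one_le_sum_sq_toReal {n : ℕ} {k : Fin n → ℤ} (hk : k ≠ 0) :
    1 ≤ ∑ i, toReal k i ^ 2 := by
  have h : 1 ≤ ‖k‖ := by
    obtain ⟨i, hi⟩ := Function.ne_iff.1 hk
    refine le_trans ?_ (norm_le_pi_norm k i)
    rw [Int.norm_eq_abs]
    exact_mod_cast Int.one_le_abs hi
  have h2 := sq_norm_le_sum_sq (toReal k)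
  rw [norm_toReal] at h2
  nlinarith

lemma term_eq_cutTerm {n : ℕ} (P : MvPolynomial (Fin n) ℂ) (a : Fin n → ℝ) (s : ℂ)
    {k : Fin n → ℤ} (hk : k ≠ 0) : term P a s k = cutTerm P s (toReal k) * char a k := by
  have h1 := one_le_sum_sq_toReal hk
  rw [term, cutTerm, if_pos h1, char]
  congr 2
  have h0 : (0 : ℝ) < ∑ i, toReal k i ^ 2 := by linarith
  have hz : znorm k = √(∑ i, toReal k i ^ 2) := rfl
  have hz0 : 0 < znorm k := hz ▸ Real.sqrt_pos.2 h0
  rw [Complex.cpow_def_of_ne_zero (by exact_mod_cast hz0.ne'),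
    Complex.cpow_def_of_ne_zero (by exact_mod_cast h0.ne'), ← Complex.ofReal_log hz0.le,
    ← Complex.ofReal_log h0.le, hz, Real.log_sqrt h0.le]
  push_cast
  ring_nf

lemma cutTerm_zero {n : ℕ} (P : MvPolynomial (Fin n) ℂ) (s : ℂ) : cutTerm P s 0 = 0 := by
  simp [cutTerm]

lemma twistedSum_eq_tsum {n : ℕ} (P : MvPolynomial (Fin n) ℂ) (a : Fin n → ℝ) (s : ℂ) :
    twistedSum P a s = ∑' k : Fin n → ℤ, cutTerm P s (toReal k) * char a k := by
  rw [twistedSum]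
  refine (tsum_congr fun k => term_eq_cutTerm P a s k.2).trans ?_
  refine tsum_subtype_eq_of_support_subset (s := {k : Fin n → ℤ | k ≠ 0})
    (f := fun k => cutTerm P s (toReal k) * char a k) fun k hk h0 => hk ?_
  simp [h0, toReal_zero, cutTerm_zero]

/-! ### Summation by parts -/

lemma differentiable_cutTerm {n : ℕ} (P : MvPolynomial (Fin n) ℂ) (x : Fin n → ℝ) :
    Differentiable ℂ fun s => cutTerm P s x := by
  unfold cutTerm
  split_ifs with h
  · refine Differentiable.const_mul (fun s => ?_) _
    refine DifferentiableAt.const_cpow (by fun_prop) (Or.inl ?_)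
    exact_mod_cast (lt_of_lt_of_le one_pos h).ne'
  · exact differentiable_const 0

lemma differentiable_fwdDiff_iter_cutTerm {n : ℕ} (P : MvPolynomial (Fin n) ℂ)
    (v x : Fin n → ℝ) (N : ℕ) : Differentiable ℂ fun s => (fwdDiff v)^[N] (cutTerm P s) x := by
  simp only [fwdDiff_iter_eq_sum_shift]
  exact Differentiable.fun_sum fun j _ => (differentiable_cutTerm P _).const_smul _

/-- The `N`-th difference of the summand in the direction of the `i`-th basis vector. -/
noncomputable def diffTerm {n : ℕ} (P : MvPolynomial (Fin n) ℂ) (i : Fin n) (N : ℕ) (s : ℂ)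
    (k : Fin n → ℤ) : ℂ :=
  (fwdDiff (toReal (Pi.single i 1)))^[N] (cutTerm P s) (toReal k)

lemma finite_norm_le_int {n : ℕ} (R : ℝ) : {k : Fin n → ℤ | ‖k‖ ≤ R}.Finite := by
  have h : {k : Fin n → ℤ | ‖k‖ ≤ R} = closedBall 0 R := by
    ext k
    simp
  rw [h]
  exact (isCompact_closedBall _ _).finite ⟨inferInstance⟩

lemma rpow_le_two_rpow_mul_one_add_rpow {X p B : ℝ} (hX : 1 ≤ X) (hp : |p| ≤ B) :
    X ^ p ≤ 2 ^ B * (1 + X) ^ p := by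
  refine (rpow_le_of_mem_Icc (B := 2) (by norm_num) (by linarith : 0 < 1 + X) (by linarith)
    (by linarith)).trans ?_
  gcongr
  norm_num

/-- The bound for differences at integer points, now for all `k` at once. -/
lemma exists_norm_diffTerm_le {n d : ℕ} {P : MvPolynomial (Fin n) ℂ} (hP : P.IsHomogeneous d)
    (N : ℕ) (M : ℝ) :
    ∃ C : ℝ, 0 ≤ C ∧ ∀ s : ℂ, ‖s‖ ≤ M → ∀ (i : Fin n) (k : Fin n → ℤ),
      ‖diffTerm P i N s k‖ ≤ C * (1 + ‖k‖) ^ ((d : ℝ) - N - s.re) := by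
  obtain ⟨C, R, hC, hR, hCR⟩ := exists_norm_fwdDiff_iter_cutTerm_le hP N M
  -- the finitely many `k` with `‖k‖ ≤ R` are bounded by continuity in `s` on a compact disc
  have hcompact : ∀ (i : Fin n) (k : Fin n → ℤ), ∃ c : ℝ, ∀ s ∈ closedBall (0 : ℂ) M,
      ‖diffTerm P i N s k * (((1 + ‖k‖) ^ (-((d : ℝ) - N - s.re)) : ℝ) : ℂ)‖ ≤ c := by
    intro i k
    refine (isCompact_closedBall (0 : ℂ) M).exists_bound_of_continuousOn
      (Continuous.continuousOn ?_)
    have h1 : Continuous fun s => diffTerm P i N s k :=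
      (differentiable_fwdDiff_iter_cutTerm P _ _ N).continuous
    have h2 : Continuous fun s : ℂ => (1 + ‖k‖) ^ (-((d : ℝ) - N - s.re)) := by
      refine Continuous.rpow continuous_const (by fun_prop) fun s => Or.inl (by positivity)
    exact h1.mul (Complex.continuous_ofReal.comp h2)
  choose c hc using hcompact
  set F := (finite_norm_le_int (n := n) R).toFinset with hF
  set B := |(d : ℝ) - N| + |M| with hB
  refine ⟨C * 2 ^ B + ∑ i, ∑ k ∈ F, |c i k|, by positivity, fun s hs i k => ?_⟩
  rcases le_or_gt ‖k‖ R with hk | hk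
  · have h1 := hc i k s (by simpa using hs)
    rw [norm_mul, Complex.norm_real, Real.norm_of_nonneg (by positivity), Real.rpow_neg
      (by positivity), ← div_eq_mul_inv, div_le_iff₀ (by positivity)] at h1
    refine h1.trans ?_
    gcongr
    have h2 : |c i k| ≤ ∑ k ∈ F, |c i k| :=
      Finset.single_le_sum (f := fun k => |c i k|) (fun _ _ => abs_nonneg _) (by simpa [hF] using hk)
    have h3 : ∑ k ∈ F, |c i k| ≤ ∑ i, ∑ k ∈ F, |c i k| :=
      Finset.single_le_sum (f := fun i => ∑ k ∈ F, |c i k|)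
        (fun _ _ => Finset.sum_nonneg fun _ _ => abs_nonneg _) (Finset.mem_univ i)
    have h4 : 0 ≤ C * 2 ^ B := by positivity
    linarith [le_abs_self (c i k)]
  · have hv : ‖toReal (Pi.single i 1 : Fin n → ℤ)‖ ≤ 1 := by
      rw [norm_toReal, pi_norm_le_iff_of_nonneg zero_le_one]
      intro j
      rcases eq_or_ne j i with rfl | hj
      · simp
      · simp [hj]
    have h1 := hCR s hs (toReal k) _ hv (by rw [norm_toReal]; exact hk.le)
    rw [norm_toReal] at h1
    refine h1.trans ?_
    have hp : |(d : ℝ) - N - s.re| ≤ B := by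
      have h2 := (Complex.abs_re_le_norm s).trans (hs.trans (le_abs_self M))
      exact (abs_sub _ _).trans (by linarith)
    have h5 := rpow_le_two_rpow_mul_one_add_rpow (hR.trans hk.le) hp
    calc C * ‖k‖ ^ ((d : ℝ) - N - s.re)
        ≤ C * (2 ^ B * (1 + ‖k‖) ^ ((d : ℝ) - N - s.re)) := by gcongr
      _ = C * 2 ^ B * (1 + ‖k‖) ^ ((d : ℝ) - N - s.re) := by ring
      _ ≤ _ := by
        gcongr
        simp only [le_add_iff_nonneg_right]
        positivity

lemma summable_norm_diffTerm {n d : ℕ} {P : MvPolynomial (Fin n) ℂ} (hP : P.IsHomogeneous d)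
    (i : Fin n) {N : ℕ} {s : ℂ} (hs : (d + n : ℝ) - N < s.re) :
    Summable fun k => ‖diffTerm P i N s k‖ := by
  obtain ⟨C, -, hCle⟩ := exists_norm_diffTerm_le hP N ‖s‖
  exact Summable.of_nonneg_of_le (fun k => norm_nonneg _) (hCle s le_rfl i)
    ((summable_one_add_norm_rpow (by linarith)).mul_left C)

/-- The twisted sum of the `N`-th difference of the summand. -/
noncomputable def diffSum {n : ℕ} (P : MvPolynomial (Fin n) ℂ) (i : Fin n) (a : Fin n → ℝ)
    (N : ℕ) (s : ℂ) : ℂ :=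
  ∑' k : Fin n → ℤ, diffTerm P i N s k * char a k

/-- The factor `e^{-2πi aᵢ} - 1` by which a difference in direction `i` multiplies the sum. -/
noncomputable def kappa {n : ℕ} (a : Fin n → ℝ) (i : Fin n) : ℂ := char a (-Pi.single i 1) - 1

lemma summable_diffTerm_mul_char {n d : ℕ} {P : MvPolynomial (Fin n) ℂ} (hP : P.IsHomogeneous d)
    (i : Fin n) (a : Fin n → ℝ) {N : ℕ} {s : ℂ} (hs : (d + n : ℝ) - N < s.re) :
    Summable fun k => diffTerm P i N s k * char a k := by
  refine Summable.of_norm ?_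
  simpa [norm_char] using summable_norm_diffTerm hP i hs

/-- Summation by parts against a character. -/
lemma tsum_sub_mul_char {n : ℕ} {D : (Fin n → ℤ) → ℂ} (a : Fin n → ℝ) (e : Fin n → ℤ)
    (hsum : Summable fun k => D k * char a k) :
    ∑' k, (D (k + e) - D k) * char a k = (char a (-e) - 1) * ∑' k, D k * char a k := by
  have hshift : Summable fun k => D (k + e) * char a (k + e) :=
    ((Equiv.addRight e).summable_iff (f := fun k => D k * char a k)).2 hsum
  have htsum : ∑' k, D (k + e) * char a (k + e) = ∑' k, D k * char a k :=
    (Equiv.addRight e).tsum_eq fun k => D k * char a k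
  have hterm : ∀ k, (D (k + e) - D k) * char a k =
      char a (-e) * (D (k + e) * char a (k + e)) - D k * char a k := by
    intro k
    have h1 : char a k = char a (-e) * char a (k + e) := by
      rw [← char_add]
      congr 1
      abel
    rw [sub_mul]
    congr 1
    rw [h1]
    ring
  rw [tsum_congr hterm, (hshift.mul_left _).tsum_sub hsum, tsum_mul_left, htsum]
  ring

lemma diffTerm_succ {n : ℕ} (P : MvPolynomial (Fin n) ℂ) (i : Fin n) (N : ℕ) (s : ℂ)
    (k : Fin n → ℤ) : diffTerm P i (N + 1) s k =
      diffTerm P i N s (k + Pi.single i 1) - diffTerm P i N s k := by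
  rw [diffTerm, diffTerm, diffTerm, Function.iterate_succ_apply', fwdDiff, toReal_add]

lemma diffSum_succ {n d : ℕ} {P : MvPolynomial (Fin n) ℂ} (hP : P.IsHomogeneous d)
    (i : Fin n) (a : Fin n → ℝ) {N : ℕ} {s : ℂ} (hs : (d + n : ℝ) - N < s.re) :
    diffSum P i a (N + 1) s = kappa a i * diffSum P i a N s := by
  simp only [diffSum, diffTerm_succ]
  exact tsum_sub_mul_char a _ (summable_diffTerm_mul_char hP i a hs)

/-! ### The entire continuation for a nontrivial twist -/

/-- The continuation of the twisted sum obtained from summation by parts in direction `i`, with a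
number of differences that makes the series at `s` converge. -/
noncomputable def contSum {n : ℕ} (d : ℕ) (P : MvPolynomial (Fin n) ℂ) (i : Fin n)
    (a : Fin n → ℝ) (s : ℂ) : ℂ :=
  diffSum P i a ⌈(d + n : ℝ) + 1 + ‖s‖⌉₊ s / kappa a i ^ ⌈(d + n : ℝ) + 1 + ‖s‖⌉₊

/-- Any larger number of differences gives the same value, because both series converge at `s`. -/
lemma contSum_eq_of_le {n d : ℕ} {P : MvPolynomial (Fin n) ℂ} (hP : P.IsHomogeneous d)
    {i : Fin n} {a : Fin n → ℝ} (ha : kappa a i ≠ 0) {s : ℂ} {N : ℕ}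
    (hN : (d + n : ℝ) + 1 + ‖s‖ ≤ N) : contSum d P i a s = diffSum P i a N s / kappa a i ^ N := by
  have hN' : ⌈(d + n : ℝ) + 1 + ‖s‖⌉₊ ≤ N := Nat.ceil_le.2 hN
  clear hN
  induction N, hN' using Nat.le_induction with
  | base => rfl
  | succ N hN ih =>
    have h1 : (d + n : ℝ) + 1 + ‖s‖ ≤ N := Nat.ceil_le.1 hN
    have h2 := (abs_le.1 (Complex.abs_re_le_norm s)).1
    rw [ih, diffSum_succ hP i a (by linarith), pow_succ', mul_div_mul_left _ _ ha]

lemma contSum_eq_twistedSum {n d : ℕ} {P : MvPolynomial (Fin n) ℂ} (hP : P.IsHomogeneous d)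
    {i : Fin n} {a : Fin n → ℝ} (ha : kappa a i ≠ 0) {s : ℂ} (hs : (d + n : ℝ) < s.re) :
    contSum d P i a s = twistedSum P a s := by
  have h : ∀ N : ℕ, diffSum P i a N s = kappa a i ^ N * twistedSum P a s := by
    intro N
    induction N with
    | zero => simp [diffSum, diffTerm, twistedSum_eq_tsum]
    | succ N ih =>
      have : (0 : ℝ) ≤ N := Nat.cast_nonneg N
      rw [diffSum_succ hP i a (by linarith), ih, pow_succ', mul_assoc]
  rw [contSum, h, mul_div_cancel_left₀ _ (pow_ne_zero _ ha)]

lemma exists_summable_bound_diffTerm {n d : ℕ} {P : MvPolynomial (Fin n) ℂ}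
    (hP : P.IsHomogeneous d) {N : ℕ} {M : ℝ} (hN : (d + n : ℝ) + 1 + M ≤ N) :
    ∃ u : (Fin n → ℤ) → ℝ, Summable u ∧ ∀ s : ℂ, ‖s‖ ≤ M → ∀ (i : Fin n) (k : Fin n → ℤ),
      ‖diffTerm P i N s k‖ ≤ u k := by
  obtain ⟨C, hC, hCle⟩ := exists_norm_diffTerm_le hP N M
  refine ⟨fun k => C * (1 + ‖k‖) ^ (-(n : ℝ) - 1),
    (summable_one_add_norm_rpow (by linarith)).mul_left C, fun s hs i k => ?_⟩
  refine (hCle s hs i k).trans ?_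
  change _ ≤ C * (1 + ‖k‖) ^ (-(n : ℝ) - 1)
  have h2 := (abs_le.1 ((Complex.abs_re_le_norm s).trans hs)).1
  refine mul_le_mul_of_nonneg_left (Real.rpow_le_rpow_of_exponent_le ?_ (by linarith)) hC
  linarith [norm_nonneg k]

lemma differentiable_contSum {n d : ℕ} {P : MvPolynomial (Fin n) ℂ} (hP : P.IsHomogeneous d)
    {i : Fin n} {a : Fin n → ℝ} (ha : kappa a i ≠ 0) : Differentiable ℂ (contSum d P i a) := by
  intro s
  obtain ⟨N, hN⟩ := exists_nat_ge ((d + n : ℝ) + 1 + (‖s‖ + 1))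
  obtain ⟨u, hu, hle⟩ := exists_summable_bound_diffTerm hP hN
  have hball : ∀ z ∈ ball (0 : ℂ) (‖s‖ + 1), ‖z‖ ≤ ‖s‖ + 1 := fun z hz =>
    (mem_ball_zero_iff.1 hz).le
  have hs : ball (0 : ℂ) (‖s‖ + 1) ∈ 𝓝 s := isOpen_ball.mem_nhds (by simp)
  have h1 : DifferentiableOn ℂ (diffSum P i a N) (ball 0 (‖s‖ + 1)) := by
    refine Complex.differentiableOn_tsum_of_summable_norm hu (fun k => ?_) isOpen_ball
      fun k z hz => ?_
    · exact ((differentiable_fwdDiff_iter_cutTerm P _ _ N).mul_const _).differentiableOn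
    · rw [norm_mul, norm_char, mul_one]
      exact hle z (hball z hz) i k
  have h2 : DifferentiableAt ℂ (fun z => diffSum P i a N z / kappa a i ^ N) s :=
    (h1.differentiableAt hs).div_const _
  refine h2.congr_of_eventuallyEq ?_
  filter_upwards [hs] with z hz
  exact contSum_eq_of_le hP ha (by linarith [hball z hz])

/-- The bound for the continuation is uniform in the twist `a`, up to a power of the distance of
`a` to resonance. -/
lemma exists_norm_contSum_le {n d : ℕ} {P : MvPolynomial (Fin n) ℂ} (hP : P.IsHomogeneous d)
    (M : ℝ) : ∃ (C : ℝ) (N : ℕ), 0 ≤ C ∧ ∀ (i : Fin n) (a : Fin n → ℝ), kappa a i ≠ 0 →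
      ∀ s : ℂ, ‖s‖ ≤ M → ‖contSum d P i a s‖ ≤ C / ‖kappa a i‖ ^ N := by
  obtain ⟨N, hN⟩ := exists_nat_ge ((d + n : ℝ) + 1 + M)
  obtain ⟨u, hu, hle⟩ := exists_summable_bound_diffTerm hP hN
  refine ⟨|∑' k, u k|, N, abs_nonneg _, fun i a ha s hs => ?_⟩
  rw [contSum_eq_of_le hP ha (by linarith), norm_div, norm_pow]
  gcongr
  refine le_trans ?_ (le_abs_self _)
  refine tsum_of_norm_bounded hu.hasSum fun k => ?_
  rw [norm_mul, norm_char, mul_one]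
  exact hle s hs i k

lemma kappa_eq {n : ℕ} (a : Fin n → ℝ) (i : Fin n) :
    kappa a i = Complex.exp (Complex.I * ((-(2 * Real.pi * a i) : ℝ) : ℂ)) - 1 := by
  have h : toReal (-Pi.single i 1 : Fin n → ℤ) ⬝ᵥ a = -a i := by
    have : toReal (-Pi.single i 1 : Fin n → ℤ) = -Pi.single i (1 : ℝ) := by
      ext j
      rcases eq_or_ne j i with rfl | hj
      · simp [toReal]
      · simp [toReal, hj]
    rw [this, neg_dotProduct, single_dotProduct, one_mul]
  rw [kappa, char, h]
  push_cast
  ring_nf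

/-- The factor `kappa a i` is at least `4` times the distance of `a i` to the nearest integer. -/
lemma four_mul_abs_sub_round_le_norm_kappa {n : ℕ} (a : Fin n → ℝ) (i : Fin n) :
    4 * |a i - round (a i)| ≤ ‖kappa a i‖ := by
  set r : ℝ := a i - round (a i) with hr
  have hr2 : |r| ≤ 1 / 2 := abs_sub_round _
  rw [kappa_eq, Complex.norm_exp_I_mul_ofReal_sub_one, Real.norm_eq_abs, abs_mul, abs_two]
  have h1 : |Real.sin (-(2 * Real.pi * a i) / 2)| = |Real.sin (Real.pi * r)| := by
    have : -(2 * Real.pi * a i) / 2 = -(Real.pi * r + round (a i) * Real.pi) := by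
      rw [hr]; ring
    rw [this, Real.sin_neg, abs_neg, Real.sin_add_int_mul_pi, abs_mul, abs_zpow, abs_neg, abs_one,
      one_zpow, one_mul]
  have h2 : |Real.sin (Real.pi * r)| = Real.sin (Real.pi * |r|) := by
    rcases abs_cases r with ⟨h, h'⟩ | ⟨h, h'⟩
    · rw [h] at hr2 ⊢
      exact abs_of_nonneg (Real.sin_nonneg_of_nonneg_of_le_pi (by positivity)
        (by nlinarith [Real.pi_pos]))
    · rw [h] at hr2 ⊢
      rw [mul_neg, Real.sin_neg, abs_of_nonpos]
      have := Real.sin_nonneg_of_nonneg_of_le_pi (x := Real.pi * -r)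
        (mul_nonneg Real.pi_pos.le (by linarith)) (by nlinarith [Real.pi_pos])
      rw [mul_neg, Real.sin_neg] at this
      linarith
  have h3 := Real.mul_le_sin (x := Real.pi * |r|) (by positivity) (by nlinarith [Real.pi_pos])
  rw [h1, h2]
  have h4 : 2 / Real.pi * (Real.pi * |r|) = 2 * |r| := by
    field_simp
  linarith

lemma exists_kappa_ne_zero {n : ℕ} {a : Fin n → ℝ} (ha : a ∉ Set.range (toReal (n := n))) :
    ∃ i, kappa a i ≠ 0 := by
  by_contra! h
  refine ha ⟨fun i => round (a i), funext fun i => ?_⟩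
  have h1 := four_mul_abs_sub_round_le_norm_kappa a i
  rw [h i, norm_zero] at h1
  have h2 : |a i - round (a i)| = 0 := le_antisymm (by linarith) (abs_nonneg _)
  rw [toReal]
  linarith [abs_eq_zero.1 h2]

lemma extendsToEntire_twistedSum {n d : ℕ} {P : MvPolynomial (Fin n) ℂ} (hP : P.IsHomogeneous d)
    {a : Fin n → ℝ} (ha : a ∉ Set.range (toReal (n := n))) :
    ExtendsToEntire (d + n) (twistedSum P a) := by
  obtain ⟨i, hi⟩ := exists_kappa_ne_zero ha
  exact ⟨contSum d P i a, differentiable_contSum hP hi, fun s hs => contSum_eq_twistedSum hP hi hs⟩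

/-! ### Functions with one simple pole -/

/-- On the half plane `σ < Re s`, the function `f` is the sum of an entire function and the polar
part `R / (s - σ)`. The case `R = 0` is allowed. -/
def HasPolarForm (σ : ℝ) (R : ℂ) (f : ℂ → ℂ) : Prop :=
  ∃ E : ℂ → ℂ, Differentiable ℂ E ∧ ∀ s : ℂ, σ < s.re → f s = E s + R / (s - σ)

lemma sub_ofReal_ne_zero_of_lt_re {σ : ℝ} {s : ℂ} (hs : σ < s.re) : s - σ ≠ 0 := by
  intro h
  rw [sub_eq_zero.1 h, Complex.ofReal_re] at hs
  exact lt_irrefl _ hs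

lemma HasPolarForm.exists_continuation {σ : ℝ} {R : ℂ} {f : ℂ → ℂ} (h : HasPolarForm σ R f) :
    ∃ F : ℂ → ℂ, IsMeromorphicContinuation σ f F ∧ (∀ z : ℂ, z ≠ σ → AnalyticAt ℂ F z) ∧
      (R ≠ 0 → HasSimplePoleWithResidue F σ R) := by
  obtain ⟨E, hE, hf⟩ := h
  have hEa : ∀ z, AnalyticAt ℂ E z := fun z => hE.analyticAt z
  have hid : ∀ s : ℂ, s ≠ σ → (s - σ) * (E s + R / (s - σ)) = (s - σ) * E s + R := by
    intro s hs
    rw [mul_add, mul_div_cancel₀ _ (sub_ne_zero.2 hs)]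
  refine ⟨fun s => E s + R / (s - σ), ⟨fun z => ?_, fun s hs => (hf s hs).symm⟩, fun z hz => ?_,
    fun hR => ⟨?_, ?_⟩⟩
  · exact (hEa z).meromorphicAt.add
      (analyticAt_const.meromorphicAt.div (analyticAt_id.sub analyticAt_const).meromorphicAt)
  · exact (hEa z).add (analyticAt_const.div (analyticAt_id.sub analyticAt_const)
      (sub_ne_zero.2 hz))
  · refine (meromorphicOrderAt_eq_int_iff (n := -1) ?_).2
      ⟨fun s => (s - σ) * E s + R, ?_, by simpa using hR, ?_⟩
    · exact (hEa _).meromorphicAt.add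
        (analyticAt_const.meromorphicAt.div (analyticAt_id.sub analyticAt_const).meromorphicAt)
    · exact ((analyticAt_id.sub analyticAt_const).mul (hEa _)).add analyticAt_const
    · filter_upwards [self_mem_nhdsWithin] with s hs
      rw [← hid s hs, zpow_neg_one, smul_eq_mul, inv_mul_cancel_left₀ (sub_ne_zero.2 hs)]
  · have h1 : Tendsto (fun s : ℂ => (s - σ) * E s + R) (𝓝 (σ : ℂ)) (𝓝 R) := by
      have hc : Continuous fun s : ℂ => (s - σ) * E s + R := by
        have := hE.continuous
        fun_prop
      simpa using hc.tendsto (σ : ℂ)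
    refine (h1.mono_left nhdsWithin_le_nhds).congr' ?_
    filter_upwards [self_mem_nhdsWithin] with s hs
    exact (hid s hs).symm

lemma HasPolarForm.extendsToEntire {σ : ℝ} {f : ℂ → ℂ} (h : HasPolarForm σ 0 f) :
    ExtendsToEntire σ f := by
  obtain ⟨E, hE, hf⟩ := h
  exact ⟨E, hE, fun s hs => by simp [hf s hs]⟩

lemma ExtendsToEntire.hasPolarForm {σ : ℝ} {f : ℂ → ℂ} (h : ExtendsToEntire σ f) :
    HasPolarForm σ 0 f := by
  obtain ⟨E, hE, hf⟩ := h
  exact ⟨E, hE, fun s hs => by simp [hf s hs]⟩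

lemma HasPolarForm.tendsto {σ : ℝ} {R : ℂ} {f : ℂ → ℂ} (h : HasPolarForm σ R f) :
    Tendsto (fun x : ℝ => ((x : ℂ) - σ) * f x) (𝓝[>] σ) (𝓝 R) := by
  obtain ⟨E, hE, hf⟩ := h
  have h1 : Tendsto (fun x : ℝ => ((x : ℂ) - σ) * E x + R) (𝓝 σ) (𝓝 R) := by
    have hc : Continuous fun x : ℝ => ((x : ℂ) - σ) * E x + R := by
      have := hE.continuous
      fun_prop
    simpa using hc.tendsto σ
  refine (h1.mono_left nhdsWithin_le_nhds).congr' ?_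
  filter_upwards [self_mem_nhdsWithin] with x hx
  have hx' : σ < (x : ℂ).re := hx
  rw [hf x hx', mul_add, mul_div_cancel₀ _ (sub_ofReal_ne_zero_of_lt_re hx')]

lemma HasPolarForm.unique {σ : ℝ} {R R' : ℂ} {f : ℂ → ℂ} (h : HasPolarForm σ R f)
    (h' : HasPolarForm σ R' f) : R = R' :=
  tendsto_nhds_unique h.tendsto h'.tendsto

/-- The residue is determined by the growth on the real half-line to the right of the pole. -/
lemma HasPolarForm.eq_of_bounded {σ : ℝ} {R S : ℂ} {f : ℂ → ℂ} (h : HasPolarForm σ R f)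
    {K : ℝ} (hK : ∀ x : ℝ, σ < x → x ≤ σ + 1 → ‖f x - S / ((x : ℂ) - σ)‖ ≤ K) : R = S := by
  refine tendsto_nhds_unique h.tendsto ?_
  rw [tendsto_iff_norm_sub_tendsto_zero]
  have h1 : Tendsto (fun x : ℝ => (x - σ) * K) (𝓝[>] σ) (𝓝 0) := by
    have hc : Continuous fun x : ℝ => (x - σ) * K := by fun_prop
    have := hc.tendsto σ
    rw [sub_self, zero_mul] at this
    exact this.mono_left nhdsWithin_le_nhds
  refine squeeze_zero' (Eventually.of_forall fun x => norm_nonneg _) ?_ h1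
  filter_upwards [Ioc_mem_nhdsGT (lt_add_one σ)] with x hx
  have hx' : σ < (x : ℂ).re := hx.1
  have e : ((x : ℂ) - σ) * f x - S = ((x : ℂ) - σ) * (f x - S / ((x : ℂ) - σ)) := by
    rw [mul_sub, mul_div_cancel₀ _ (sub_ofReal_ne_zero_of_lt_re hx')]
  rw [e, norm_mul, ← Complex.ofReal_sub, Complex.norm_real, Real.norm_of_nonneg (by linarith [hx.1])]
  exact mul_le_mul_of_nonneg_left (by simpa using hK x hx.1 hx.2) (by linarith [hx.1])

/-- Since `log 2 / log 3` is irrational, `2 ^ z` and `3 ^ z` are both `1` only at `z = 0`. -/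
lemma eq_zero_of_two_cpow_eq_one_of_three_cpow_eq_one {z : ℂ} (h2 : (2 : ℂ) ^ z = 1)
    (h3 : (3 : ℂ) ^ z = 1) : z = 0 := by
  rw [Complex.cpow_def_of_ne_zero (by norm_num), Complex.exp_eq_one_iff] at h2 h3
  obtain ⟨j, hj⟩ := h2
  obtain ⟨k, hk⟩ := h3
  have e2 : Complex.log 2 = (Real.log 2 : ℝ) := by
    rw [Complex.ofReal_log (by norm_num)]; norm_num
  have e3 : Complex.log 3 = (Real.log 3 : ℝ) := by
    rw [Complex.ofReal_log (by norm_num)]; norm_num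
  rw [e2] at hj
  rw [e3] at hk
  have hpi := Complex.two_pi_I_ne_zero
  have hl2 : 0 < Real.log 2 := Real.log_pos (by norm_num)
  have hl3 : 0 < Real.log 3 := Real.log_pos (by norm_num)
  have hcross : (j : ℝ) * Real.log 3 = k * Real.log 2 := by
    have : (j : ℂ) * (Real.log 3 : ℝ) = k * (Real.log 2 : ℝ) := by
      apply mul_right_cancel₀ hpi
      linear_combination -((Real.log 3 : ℝ) : ℂ) * hj + ((Real.log 2 : ℝ) : ℂ) * hk
    exact_mod_cast this
  have habs : (j.natAbs : ℝ) * Real.log 3 = k.natAbs * Real.log 2 := by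
    have := congrArg abs hcross
    rw [abs_mul, abs_mul, abs_of_pos hl2, abs_of_pos hl3] at this
    rw [Nat.cast_natAbs, Nat.cast_natAbs]
    exact_mod_cast this
  have hpow : 3 ^ j.natAbs = 2 ^ k.natAbs := by
    have h : (3 : ℝ) ^ j.natAbs = 2 ^ k.natAbs := by
      rw [← Real.log_pow, ← Real.log_pow] at habs
      exact Real.log_injOn_pos (Set.mem_Ioi.2 (by positivity)) (Set.mem_Ioi.2 (by positivity)) habs
    exact_mod_cast h
  have hj0 : k.natAbs = 0 := by
    by_contra hk0
    have hodd : Odd (3 ^ j.natAbs) := Odd.pow (by decide)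
    rw [hpow] at hodd
    exact (Nat.not_odd_iff_even.2 ((even_two).pow_of_ne_zero hk0)) hodd
  rw [Int.natAbs_eq_zero.1 hj0, Int.cast_zero, zero_mul] at hk
  exact (mul_eq_zero.1 hk).resolve_left (by exact_mod_cast hl3.ne')

/-- Two entire factors without a common zero, whose products with an unknown function are entire,
determine an entire function. -/
lemma exists_entire_quotient {h₁ h₂ E₁ E₂ : ℂ → ℂ} (hh₁ : Differentiable ℂ h₁)
    (hh₂ : Differentiable ℂ h₂) (hE₁ : Differentiable ℂ E₁) (hE₂ : Differentiable ℂ E₂)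
    (hcross : ∀ z, E₁ z * h₂ z = E₂ z * h₁ z) (hne : ∀ z, h₁ z ≠ 0 ∨ h₂ z ≠ 0) :
    ∃ H : ℂ → ℂ, Differentiable ℂ H ∧ ∀ z, h₁ z ≠ 0 → H z = E₁ z / h₁ z := by
  classical
  refine ⟨fun z => if h₁ z ≠ 0 then E₁ z / h₁ z else E₂ z / h₂ z, fun z => ?_, fun z hz => if_pos hz⟩
  rcases hne z with hz | hz
  · refine ((hE₁ z).div (hh₁ z) hz).congr_of_eventuallyEq ?_
    filter_upwards [(hh₁ z).continuousAt.eventually_ne hz] with y hy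
    simp [hy]
  · refine ((hE₂ z).div (hh₂ z) hz).congr_of_eventuallyEq ?_
    filter_upwards [(hh₂ z).continuousAt.eventually_ne hz] with y hy
    split_ifs with h
    · rw [Pi.div_apply, div_eq_div_iff h hy, hcross]
    · rfl

/-- The factors `m ^ (σ - s) - 1` with `m = 2, 3` are `s - σ` times entire functions without a common
zero, so that `(s - σ) f(s)` is entire. -/
lemma hasPolarForm_of_cpow_mul {σ : ℝ} {f E₂ E₃ : ℂ → ℂ} (hE₂ : Differentiable ℂ E₂)
    (hE₃ : Differentiable ℂ E₃)
    (h₂ : ∀ s : ℂ, σ < s.re → ((2 : ℂ) ^ ((σ : ℂ) - s) - 1) * f s = E₂ s)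
    (h₃ : ∀ s : ℂ, σ < s.re → ((3 : ℂ) ^ ((σ : ℂ) - s) - 1) * f s = E₃ s) :
    ∃ R, HasPolarForm σ R f := by
  have hd : ∀ m : ℂ, m ≠ 0 → Differentiable ℂ fun s : ℂ => m ^ ((σ : ℂ) - s) - 1 := fun m hm s =>
    (DifferentiableAt.const_cpow (by fun_prop) (Or.inl hm)).sub_const _
  have hslope : ∀ {g : ℂ → ℂ}, Differentiable ℂ g → Differentiable ℂ (dslope g σ) := by
    intro g hg
    rw [← differentiableOn_univ] at hg ⊢
    exact (Complex.differentiableOn_dslope univ_mem).2 hg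
  have hfac : ∀ (m s : ℂ), m ^ ((σ : ℂ) - s) - 1 =
      (s - σ) * dslope (fun s : ℂ => m ^ ((σ : ℂ) - s) - 1) σ s := by
    intro m s
    have := sub_smul_dslope (fun s : ℂ => m ^ ((σ : ℂ) - s) - 1) (σ : ℂ) s
    rw [smul_eq_mul] at this
    rw [this]
    simp
  set q₂ := dslope (fun s : ℂ => (2 : ℂ) ^ ((σ : ℂ) - s) - 1) σ with hq₂
  set q₃ := dslope (fun s : ℂ => (3 : ℂ) ^ ((σ : ℂ) - s) - 1) σ with hq₃
  have dq₂ : Differentiable ℂ q₂ := hslope (hd 2 (by norm_num))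
  have dq₃ : Differentiable ℂ q₃ := hslope (hd 3 (by norm_num))
  have hcross : ∀ z, E₂ z * q₃ z = E₃ z * q₂ z := by
    have ha : AnalyticOnNhd ℂ (fun z => E₂ z * q₃ z) Set.univ := fun z _ =>
      (hE₂.mul dq₃).analyticAt z
    have hb : AnalyticOnNhd ℂ (fun z => E₃ z * q₂ z) Set.univ := fun z _ =>
      (hE₃.mul dq₂).analyticAt z
    refine fun z => congrFun (ha.eq_of_eventuallyEq hb (z₀ := (σ : ℂ) + 1) ?_) z
    have hopen : IsOpen {s : ℂ | σ < s.re} := isOpen_lt continuous_const Complex.continuous_re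
    filter_upwards [hopen.mem_nhds (show σ < ((σ : ℂ) + 1).re by simp)] with s hs
    rw [← h₂ s hs, ← h₃ s hs, hfac 2 s, hfac 3 s]
    ring
  have hne : ∀ z, q₂ z ≠ 0 ∨ q₃ z ≠ 0 := by
    intro z
    by_contra! h
    rcases eq_or_ne z σ with rfl | hz
    · -- at the pole itself, the factor is the derivative of `2 ^ (σ - s)`, which is `-log 2`
      have h1 : HasDerivAt (fun s : ℂ => (2 : ℂ) ^ ((σ : ℂ) - s) - 1)
          ((2 : ℂ) ^ ((σ : ℂ) - σ) * Complex.log 2 * -1) σ :=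
        (((hasDerivAt_id (σ : ℂ)).const_sub (σ : ℂ)).const_cpow
          (Or.inl (by norm_num))).sub_const 1
      have h2 := h.1
      rw [hq₂, dslope_same, h1.deriv, sub_self, Complex.cpow_zero, one_mul, mul_neg_one,
        neg_eq_zero] at h2
      have h3 := Complex.exp_log (two_ne_zero (α := ℂ))
      rw [h2, Complex.exp_zero] at h3
      norm_num at h3
    · have e2 := hfac 2 z
      have e3 := hfac 3 z
      rw [← hq₂, h.1, mul_zero, sub_eq_zero] at e2
      rw [← hq₃, h.2, mul_zero, sub_eq_zero] at e3
      exact hz (sub_eq_zero.1 (eq_zero_of_two_cpow_eq_one_of_three_cpow_eq_one e2 e3)).symm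
  obtain ⟨H, hH, hHq⟩ := exists_entire_quotient dq₂ dq₃ hE₂ hE₃ hcross hne
  refine ⟨H σ, dslope H σ, hslope hH, fun s hs => ?_⟩
  have hs0 := sub_ofReal_ne_zero_of_lt_re hs
  have hq : q₂ s ≠ 0 := by
    intro h0
    have e2 := hfac 2 s
    rw [← hq₂, h0, mul_zero, sub_eq_zero] at e2
    have h1 := congrArg norm e2
    rw [norm_one, show (2 : ℂ) = ((2 : ℝ) : ℂ) by norm_num,
      Complex.norm_cpow_eq_rpow_re_of_pos two_pos, Complex.sub_re, Complex.ofReal_re] at h1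
    have := Real.rpow_lt_one_of_one_lt_of_neg (x := 2) one_lt_two (sub_neg.2 hs)
    linarith
  have hHs : H s = (s - σ) * f s := by
    rw [hHq s hq, ← h₂ s hs, hfac 2 s, ← hq₂]
    field_simp
  have h4 := sub_smul_dslope H (σ : ℂ) s
  rw [smul_eq_mul, hHs] at h4
  field_simp
  linear_combination -h4

/-! ### The distribution relation -/

lemma eval_const_mul {n d : ℕ} {P : MvPolynomial (Fin n) ℂ} (hP : P.IsHomogeneous d) (c : ℂ)
    (y : Fin n → ℂ) :
    MvPolynomial.eval (fun i => c * y i) P = c ^ d * MvPolynomial.eval y P := by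
  rw [MvPolynomial.eval_eq', MvPolynomial.eval_eq', Finset.mul_sum]
  refine Finset.sum_congr rfl fun m hm => ?_
  simp only [mul_pow]
  rw [Finset.prod_mul_distrib, Finset.prod_pow_eq_pow_sum, sum_eq_of_mem_support hP hm]
  ring

lemma ofReal_sq_mul_cpow {c S : ℝ} (hc : 0 < c) (hS : 0 ≤ S) (s : ℂ) :
    ((c ^ 2 * S : ℝ) : ℂ) ^ (-s / 2) = (c : ℂ) ^ (-s) * (S : ℂ) ^ (-s / 2) := by
  rw [Complex.ofReal_mul, Complex.mul_cpow_ofReal_nonneg (by positivity) hS]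
  congr 1
  have hc' : (c : ℂ) ≠ 0 := by exact_mod_cast hc.ne'
  rw [Complex.cpow_def_of_ne_zero (by exact_mod_cast (pow_pos hc 2).ne'),
    Complex.cpow_def_of_ne_zero hc', ← Complex.ofReal_log (by positivity), ←
    Complex.ofReal_log hc.le, Real.log_pow]
  push_cast
  ring_nf

lemma cutTerm_eq_of_le {n : ℕ} (P : MvPolynomial (Fin n) ℂ) (s : ℂ) {x : Fin n → ℝ}
    (hx : 1 ≤ ∑ i, x i ^ 2) : cutTerm P s x =
      MvPolynomial.eval (fun i => (x i : ℂ)) P * ((∑ i, x i ^ 2 : ℝ) : ℂ) ^ (-s / 2) :=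
  if_pos hx

lemma cutTerm_natCast_smul {n d : ℕ} {P : MvPolynomial (Fin n) ℂ} (hP : P.IsHomogeneous d)
    (s : ℂ) {m : ℕ} (hm : 0 < m) (k : Fin n → ℤ) :
    cutTerm P s (toReal (fun i => (m : ℤ) * k i)) =
      (m : ℂ) ^ ((d : ℂ) - s) * cutTerm P s (toReal k) := by
  have hm' : (0 : ℝ) < m := by exact_mod_cast hm
  have hmC : (m : ℂ) ≠ 0 := by exact_mod_cast hm.ne'
  rcases eq_or_ne k 0 with rfl | hk
  · have : (fun i => (m : ℤ) * (0 : Fin n → ℤ) i) = 0 := by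
      ext i
      simp
    rw [this, toReal_zero, cutTerm_zero, mul_zero]
  have hmk : (fun i => (m : ℤ) * k i) ≠ 0 := by
    obtain ⟨i, hi⟩ := Function.ne_iff.1 hk
    refine Function.ne_iff.2 ⟨i, mul_ne_zero (by exact_mod_cast hm.ne') hi⟩
  rw [cutTerm_eq_of_le P s (one_le_sum_sq_toReal hmk), cutTerm_eq_of_le P s (one_le_sum_sq_toReal hk)]
  have e1 : ∀ i, toReal (fun i => (m : ℤ) * k i) i = m * toReal k i := by
    intro i
    simp [toReal]
  have e2 : ∑ i, toReal (fun i => (m : ℤ) * k i) i ^ 2 = (m : ℝ) ^ 2 * ∑ i, toReal k i ^ 2 := by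
    rw [Finset.mul_sum]
    exact Finset.sum_congr rfl fun i _ => by rw [e1]; ring
  rw [e2, ofReal_sq_mul_cpow hm' (by positivity)]
  simp only [e1, Complex.ofReal_mul]
  rw [eval_const_mul hP, sub_eq_add_neg, Complex.cpow_add _ _ hmC, Complex.cpow_natCast]
  push_cast
  ring

lemma sum_exp_div_eq_ite {m : ℕ} (hm : 0 < m) (k : ℤ) :
    ∑ j : Fin m, Complex.exp (2 * Real.pi * Complex.I * ((k * ((j : ℕ) / m : ℝ) : ℝ) : ℂ)) =
      if (m : ℤ) ∣ k then (m : ℂ) else 0 := by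
  have hmC : (m : ℂ) ≠ 0 := by exact_mod_cast hm.ne'
  set ζ : ℂ := Complex.exp (2 * Real.pi * Complex.I * (k / m)) with hζ
  have hterm : ∀ j : Fin m,
      Complex.exp (2 * Real.pi * Complex.I * ((k * ((j : ℕ) / m : ℝ) : ℝ) : ℂ)) = ζ ^ (j : ℕ) := by
    intro j
    rw [hζ, ← Complex.exp_nat_mul]
    congr 1
    push_cast
    ring
  rw [Finset.sum_congr rfl fun j _ => hterm j, Fin.sum_univ_eq_sum_range (fun j => ζ ^ j)]
  have hζ1 : ζ = 1 ↔ (m : ℤ) ∣ k := by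
    rw [hζ, Complex.exp_eq_one_iff]
    constructor
    · rintro ⟨j, hj⟩
      refine ⟨j, ?_⟩
      have h1 : (k : ℂ) / m = j := by
        apply mul_left_cancel₀ Complex.two_pi_I_ne_zero
        rw [hj]
        ring
      rw [div_eq_iff hmC] at h1
      have : (k : ℂ) = ((m * j : ℤ) : ℂ) := by
        rw [h1]
        push_cast
        ring
      exact_mod_cast this
    · rintro ⟨j, rfl⟩
      refine ⟨j, ?_⟩
      push_cast
      field_simp
  have hζm : ζ ^ m = 1 := by
    rw [hζ, ← Complex.exp_nat_mul, Complex.exp_eq_one_iff]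
    refine ⟨k, ?_⟩
    field_simp
  split_ifs with h
  · simp [hζ1.2 h]
  · rw [geom_sum_eq (fun h' => h (hζ1.1 h')), hζm, sub_self, zero_div]

lemma char_eq_prod {n : ℕ} (a : Fin n → ℝ) (k : Fin n → ℤ) :
    char a k = ∏ i, Complex.exp (2 * Real.pi * Complex.I * ((k i * a i : ℝ) : ℂ)) := by
  rw [char, ← Complex.exp_sum, ← Finset.mul_sum]
  congr 2
  rw [dotProduct]
  push_cast
  rfl

/-- The point `c / m` of the `m`-torsion of `ℝⁿ / ℤⁿ`. -/
noncomputable def torsionPoint {n m : ℕ} (c : Fin n → Fin m) : Fin n → ℝ :=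
  fun i => ((c i : ℕ) : ℝ) / m

lemma sum_char_torsionPoint {n m : ℕ} (hm : 0 < m) (k : Fin n → ℤ) :
    ∑ c : Fin n → Fin m, char (torsionPoint c) k =
      if ∀ i, (m : ℤ) ∣ k i then (m : ℂ) ^ n else 0 := by
  simp only [char_eq_prod, torsionPoint]
  have hprod := Finset.prod_univ_sum (fun _ : Fin n => (Finset.univ : Finset (Fin m))) fun i j =>
    Complex.exp (2 * Real.pi * Complex.I * ((k i * ((j : ℕ) / m : ℝ) : ℝ) : ℂ))
  rw [Fintype.piFinset_univ] at hprod
  rw [← hprod]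
  simp only [sum_exp_div_eq_ite hm]
  split_ifs with h
  · rw [Finset.prod_congr rfl fun i _ => if_pos (h i)]
    simp
  · obtain ⟨i, hi⟩ := not_forall.1 h
    exact Finset.prod_eq_zero (Finset.mem_univ i) (if_neg hi)

lemma summable_cutTerm {n d : ℕ} {P : MvPolynomial (Fin n) ℂ} (hP : P.IsHomogeneous d) {s : ℂ}
    (hs : (d + n : ℝ) < s.re) : Summable fun k : Fin n → ℤ => ‖cutTerm P s (toReal k)‖ := by
  rcases Nat.eq_zero_or_pos n with rfl | hn
  · exact (hasSum_fintype _).summable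
  · exact summable_norm_diffTerm (N := 0) hP ⟨0, hn⟩ (by simpa using hs)

lemma summable_cutTerm_mul_char {n d : ℕ} {P : MvPolynomial (Fin n) ℂ} (hP : P.IsHomogeneous d)
    (a : Fin n → ℝ) {s : ℂ} (hs : (d + n : ℝ) < s.re) :
    Summable fun k : Fin n → ℤ => cutTerm P s (toReal k) * char a k := by
  refine Summable.of_norm ?_
  simpa [norm_char] using summable_cutTerm hP hs

/-- Summing over the `m`-torsion points picks out the multiples of `m`, on which the summand is
homogeneous. -/
lemma sum_twistedSum_torsionPoint {n d m : ℕ} {P : MvPolynomial (Fin n) ℂ}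
    (hP : P.IsHomogeneous d) (hm : 0 < m) {s : ℂ} (hs : (d + n : ℝ) < s.re) :
    ∑ c : Fin n → Fin m, twistedSum P (torsionPoint c) s =
      (m : ℂ) ^ (((d + n : ℝ) : ℂ) - s) * twistedSum P 0 s := by
  have hmC : (m : ℂ) ≠ 0 := by exact_mod_cast hm.ne'
  have hmZ : (m : ℤ) ≠ 0 := by exact_mod_cast hm.ne'
  simp only [twistedSum_eq_tsum]
  rw [← Summable.tsum_finsetSum fun c _ => summable_cutTerm_mul_char hP _ hs]
  simp only [← Finset.mul_sum, sum_char_torsionPoint hm]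
  have hinj : Function.Injective fun (k : Fin n → ℤ) (i : Fin n) => (m : ℤ) * k i := by
    intro k l h
    ext i
    exact mul_left_cancel₀ hmZ (congrFun h i)
  rw [← hinj.tsum_eq, ← tsum_mul_left]
  · refine tsum_congr fun k => ?_
    have h0 : char (0 : Fin n → ℝ) k = 1 := by simp [char]
    rw [if_pos fun i => dvd_mul_right _ _, cutTerm_natCast_smul hP s hm, h0, mul_one]
    rw [show (((d + n : ℝ) : ℂ) - s) = ((d : ℂ) - s) + n by push_cast; ring,
      Complex.cpow_add _ _ hmC, Complex.cpow_natCast]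
    ring
  · intro k hk
    by_cases h : ∀ i, (m : ℤ) ∣ k i
    · choose l hl using h
      exact ⟨l, funext fun i => (hl i).symm⟩
    · simp [h] at hk

lemma torsionPoint_notMem_range {n m : ℕ} [NeZero m] {c : Fin n → Fin m} (hc : c ≠ 0) :
    torsionPoint c ∉ Set.range (toReal (n := n)) := by
  rintro ⟨k, hk⟩
  obtain ⟨i, hi⟩ := Function.ne_iff.1 hc
  have hm : (0 : ℝ) < m := by exact_mod_cast Nat.pos_of_ne_zero (NeZero.ne m)
  have h1 : (k i : ℝ) = ((c i : ℕ) : ℝ) / m := congrFun hk i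
  have hci : (0 : ℝ) < ((c i : ℕ) : ℝ) := by
    have : (c i : ℕ) ≠ 0 := fun h => hi (Fin.ext (by simpa using h))
    exact_mod_cast Nat.pos_of_ne_zero this
  have h2 : (0 : ℝ) < k i := by rw [h1]; positivity
  have h3 : (k i : ℝ) < 1 := by
    rw [h1, div_lt_one hm]
    exact_mod_cast (c i).2
  have h4 : 0 < k i := by exact_mod_cast h2
  have h5 : k i < 1 := by exact_mod_cast h3
  omega

lemma torsionPoint_zero {n m : ℕ} [NeZero m] : torsionPoint (0 : Fin n → Fin m) = 0 := by
  ext i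
  simp [torsionPoint]

lemma exists_entire_cpow_mul_twistedSum {n d : ℕ} {P : MvPolynomial (Fin n) ℂ}
    (hP : P.IsHomogeneous d) (m : ℕ) [NeZero m] :
    ∃ E : ℂ → ℂ, Differentiable ℂ E ∧ ∀ s : ℂ, (d + n : ℝ) < s.re →
      ((m : ℂ) ^ (((d + n : ℝ) : ℂ) - s) - 1) * twistedSum P 0 s = E s := by
  have h : ∀ c : Fin n → Fin m, ∃ E : ℂ → ℂ, Differentiable ℂ E ∧
      (c ≠ 0 → ∀ s : ℂ, (d + n : ℝ) < s.re → E s = twistedSum P (torsionPoint c) s) := by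
    intro c
    by_cases hc : c = 0
    · exact ⟨0, differentiable_const 0, fun h => absurd hc h⟩
    · obtain ⟨E, hE, hEs⟩ := extendsToEntire_twistedSum hP (torsionPoint_notMem_range hc)
      exact ⟨E, hE, fun _ => hEs⟩
  choose E hE hEs using h
  classical
  refine ⟨fun s => ∑ c ∈ Finset.univ.erase 0, E c s, Differentiable.fun_sum fun c _ => hE c,
    fun s hs => ?_⟩
  rw [sub_mul, ← sum_twistedSum_torsionPoint hP (Nat.pos_of_ne_zero (NeZero.ne m)) hs,
    ← Finset.add_sum_erase _ _ (Finset.mem_univ (0 : Fin n → Fin m)), torsionPoint_zero, one_mul,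
    add_sub_cancel_left]
  exact Finset.sum_congr rfl fun c hc => (hEs c (Finset.ne_of_mem_erase hc) s hs).symm

lemma exists_hasPolarForm_twistedSum_zero {n d : ℕ} {P : MvPolynomial (Fin n) ℂ}
    (hP : P.IsHomogeneous d) : ∃ R, HasPolarForm (d + n) R (twistedSum P 0) := by
  obtain ⟨E₂, hE₂, h₂⟩ := exists_entire_cpow_mul_twistedSum hP 2
  obtain ⟨E₃, hE₃, h₃⟩ := exists_entire_cpow_mul_twistedSum hP 3
  exact hasPolarForm_of_cpow_mul hE₂ hE₃ (by simpa using h₂) (by simpa using h₃)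

/-! ### The integral of the summand in polar coordinates -/

/-- The radial part `r ^ (d - t)`, for `r ≥ 1`, of the cut-off summand at a real point `t`. -/
noncomputable def radialPart (d : ℕ) (t r : ℝ) : ℝ :=
  (Set.Ici (1 : ℝ)).indicator (fun r => r ^ ((d : ℝ) - t)) r

lemma sum_sq_mul {n : ℕ} (r : ℝ) {u : Fin n → ℝ} (hu : ∑ i, u i ^ 2 = 1) :
    ∑ i, (r * u i) ^ 2 = r ^ 2 := by
  simp only [mul_pow]
  rw [← Finset.mul_sum, hu, mul_one]

lemma cutTerm_polar {n d : ℕ} {P : MvPolynomial (Fin n) ℂ} (hP : P.IsHomogeneous d) (t : ℝ)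
    {r : ℝ} (hr : 0 < r) {u : Fin n → ℝ} (hu : ∑ i, u i ^ 2 = 1) :
    cutTerm P t (fun i => r * u i) =
      MvPolynomial.eval (fun i => (u i : ℂ)) P * (radialPart d t r : ℂ) := by
  rw [cutTerm, sum_sq_mul r hu, radialPart, Set.indicator_apply]
  have h1 : 1 ≤ r ^ 2 ↔ r ∈ Set.Ici (1 : ℝ) := by
    rw [Set.mem_Ici, one_le_sq_iff₀ hr.le]
  by_cases h : r ∈ Set.Ici (1 : ℝ)
  · rw [if_pos (h1.2 h), if_pos h]
    have h2 := ofReal_sq_mul_cpow hr zero_le_one (t : ℂ)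
    rw [mul_one, Complex.ofReal_one, Complex.one_cpow, mul_one] at h2
    simp only [Complex.ofReal_mul]
    rw [h2, eval_const_mul hP, sub_eq_add_neg, Real.rpow_add hr, Real.rpow_natCast,
      Complex.ofReal_mul, Complex.ofReal_cpow hr.le]
    push_cast
    ring
  · rw [if_neg (fun h' => h (h1.1 h')), if_neg h]
    simp

lemma pow_smul_radialPart {n d : ℕ} (hn : 0 < n) (t : ℝ) :
    (fun r : ℝ => r ^ (n - 1) • radialPart d t r) =
      (Set.Ici (1 : ℝ)).indicator fun r => r ^ ((d + n : ℝ) - t - 1) := by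
  ext r
  rw [radialPart, Set.indicator_apply, Set.indicator_apply]
  split_ifs with h
  · have hr : 0 < r := lt_of_lt_of_le one_pos h
    rw [smul_eq_mul, ← Real.rpow_natCast, ← Real.rpow_add hr]
    congr 1
    push_cast [Nat.cast_sub hn]
    ring
  · simp

lemma Ioi_inter_Ici_one : Set.Ioi (0 : ℝ) ∩ Set.Ici 1 = Set.Ici 1 :=
  Set.inter_eq_right.2 fun _ hx => Set.mem_Ioi.2 (lt_of_lt_of_le one_pos (Set.mem_Ici.1 hx))

lemma integrableOn_pow_smul_radialPart {n d : ℕ} (hn : 0 < n) {t : ℝ} (ht : (d + n : ℝ) < t) :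
    IntegrableOn (fun r : ℝ => r ^ (n - 1) • radialPart d t r) (Set.Ioi 0) := by
  rw [pow_smul_radialPart hn, IntegrableOn, integrable_indicator_iff measurableSet_Ici,
    IntegrableOn, Measure.restrict_restrict measurableSet_Ici, Set.inter_comm, Ioi_inter_Ici_one]
  exact (integrableOn_Ici_iff_integrableOn_Ioi).2
    (integrableOn_Ioi_rpow_of_lt (by linarith) one_pos)

lemma integral_pow_smul_radialPart {n d : ℕ} (hn : 0 < n) {t : ℝ} (ht : (d + n : ℝ) < t) :
    ∫ r in Set.Ioi (0 : ℝ), r ^ (n - 1) • radialPart d t r = 1 / (t - (d + n)) := by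
  rw [pow_smul_radialPart hn, setIntegral_indicator measurableSet_Ici, Ioi_inter_Ici_one,
    integral_Ici_eq_integral_Ioi, integral_Ioi_rpow_of_lt (by linarith) one_pos, Real.one_rpow]
  rw [show (d + n : ℝ) - t - 1 + 1 = -(t - (d + n)) by ring, neg_div_neg_eq]

lemma sum_sq_sphere {n : ℕ} (u : sphere (0 : EuclideanSpace ℝ (Fin n)) 1) :
    ∑ i, (u : EuclideanSpace ℝ (Fin n)) i ^ 2 = 1 := by
  rw [← EuclideanSpace.real_norm_sq_eq, norm_eq_of_mem_sphere, one_pow]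

lemma cutTerm_ofLp_eq {n d : ℕ} {P : MvPolynomial (Fin n) ℂ} (hP : P.IsHomogeneous d) (t : ℝ)
    (y : ({0}ᶜ : Set (EuclideanSpace ℝ (Fin n)))) :
    cutTerm P t (fun i => (y : EuclideanSpace ℝ (Fin n)) i) =
      MvPolynomial.eval (fun i => ((((homeomorphUnitSphereProd _ y).1 :
        EuclideanSpace ℝ (Fin n)) i : ℝ) : ℂ)) P *
        (radialPart d t ((homeomorphUnitSphereProd _ y).2 : ℝ) : ℂ) := by
  rw [← cutTerm_polar hP t (homeomorphUnitSphereProd _ y).2.2 (sum_sq_sphere _)]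
  congr 1
  ext i
  have h := congrArg (Subtype.val) ((homeomorphUnitSphereProd _).symm_apply_apply y)
  rw [homeomorphUnitSphereProd_symm_apply_coe] at h
  conv_lhs => rw [← h]
  rfl

lemma integral_volumeIoiPow (m : ℕ) (f : ℝ → ℝ) :
    ∫ r : Set.Ioi (0 : ℝ), f r ∂Measure.volumeIoiPow m =
      ∫ r in Set.Ioi (0 : ℝ), r ^ m • f r := by
  simp only [Measure.volumeIoiPow, ENNReal.ofReal]
  rw [integral_withDensity_eq_integral_smul,
    integral_subtype_comap measurableSet_Ioi fun a ↦ Real.toNNReal (a ^ m) • f a,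
    setIntegral_congr_fun measurableSet_Ioi fun x hx ↦ ?_]
  · rw [NNReal.smul_def, Real.coe_toNNReal _ (pow_nonneg hx.out.le _)]
  · exact (measurable_subtype_coe.pow_const _).real_toNNReal

lemma integral_cutTerm_euclidean {n d : ℕ} {P : MvPolynomial (Fin n) ℂ} (hP : P.IsHomogeneous d)
    (hn : 0 < n) {t : ℝ} (ht : (d + n : ℝ) < t) :
    ∫ y : EuclideanSpace ℝ (Fin n), cutTerm P t (fun i => y i) =
      sphereIntegral P / ((t : ℂ) - ((d + n : ℝ) : ℂ)) := by
  have : Nonempty (Fin n) := ⟨⟨0, hn⟩⟩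
  have hdim : Module.finrank ℝ (EuclideanSpace ℝ (Fin n)) = n := by simp
  calc ∫ y : EuclideanSpace ℝ (Fin n), cutTerm P t (fun i => y i)
      = ∫ y : ({0}ᶜ : Set (EuclideanSpace ℝ (Fin n))),
          cutTerm P t (fun i => (y : EuclideanSpace ℝ (Fin n)) i) ∂(Measure.comap Subtype.val volume) := by
        rw [integral_subtype_comap (measurableSet_singleton _).compl
          fun y : EuclideanSpace ℝ (Fin n) => cutTerm P t (fun i => y i), restrict_compl_singleton]
    _ = ∫ z : sphere (0 : EuclideanSpace ℝ (Fin n)) 1 × Set.Ioi (0 : ℝ),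
          MvPolynomial.eval (fun i => (((z.1 : EuclideanSpace ℝ (Fin n)) i : ℝ) : ℂ)) P *
            (radialPart d t (z.2 : ℝ) : ℂ)
          ∂((volume : Measure (EuclideanSpace ℝ (Fin n))).toSphere.prod
            (Measure.volumeIoiPow (n - 1))) := by
        have h := (volume : Measure (EuclideanSpace ℝ (Fin n))).measurePreserving_homeomorphUnitSphereProd
        rw [hdim] at h
        rw [← h.integral_comp (Homeomorph.measurableEmbedding _)]
        exact integral_congr_ae (Eventually.of_forall fun y => cutTerm_ofLp_eq hP t y)
    _ = sphereIntegral P *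
          ∫ r : Set.Ioi (0 : ℝ), (radialPart d t r : ℂ) ∂Measure.volumeIoiPow (n - 1) :=
        integral_prod_mul
          (fun u : sphere (0 : EuclideanSpace ℝ (Fin n)) 1 =>
            MvPolynomial.eval (fun i => (((u : EuclideanSpace ℝ (Fin n)) i : ℝ) : ℂ)) P)
          (fun r : Set.Ioi (0 : ℝ) => (radialPart d t r : ℂ))
    _ = _ := by
        have hcast : ∫ r : Set.Ioi (0 : ℝ), (radialPart d t r : ℂ) ∂Measure.volumeIoiPow (n - 1) =
            ((∫ r : Set.Ioi (0 : ℝ), radialPart d t r ∂Measure.volumeIoiPow (n - 1) : ℝ) : ℂ) :=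
          integral_ofReal
        rw [hcast, integral_volumeIoiPow, integral_pow_smul_radialPart hn ht]
        push_cast
        rw [mul_one_div]

lemma norm_ofLp_le_one {n : ℕ} (u : sphere (0 : EuclideanSpace ℝ (Fin n)) 1) :
    ‖fun i => (((u : EuclideanSpace ℝ (Fin n)) i : ℝ) : ℂ)‖ ≤ 1 := by
  rw [pi_norm_le_iff_of_nonneg zero_le_one]
  intro i
  rw [Complex.norm_real]
  exact (PiLp.norm_apply_le _ i).trans (norm_eq_of_mem_sphere u).le

lemma measurable_cutTerm {n : ℕ} (P : MvPolynomial (Fin n) ℂ) (s : ℂ) :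
    Measurable (cutTerm P s) := by
  have h1 : Measurable fun x : Fin n → ℝ => ∑ i, x i ^ 2 := by fun_prop
  refine Measurable.ite (measurableSet_le measurable_const h1) (Measurable.mul ?_ ?_)
    measurable_const
  · simp only [MvPolynomial.eval_eq']
    fun_prop
  · exact (Complex.measurable_ofReal.comp h1).pow_const _

lemma integrable_cutTerm_euclidean {n d : ℕ} {P : MvPolynomial (Fin n) ℂ}
    (hP : P.IsHomogeneous d) (hn : 0 < n) {t : ℝ} (ht : (d + n : ℝ) < t) :
    Integrable fun y : EuclideanSpace ℝ (Fin n) => cutTerm P t (fun i => y i) := by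
  have : Nonempty (Fin n) := ⟨⟨0, hn⟩⟩
  have hdim : Module.finrank ℝ (EuclideanSpace ℝ (Fin n)) = n := by simp
  obtain ⟨C, hC, hCle⟩ := exists_norm_eval_le hP
  have hrad : Integrable fun y : EuclideanSpace ℝ (Fin n) => radialPart d t ‖y‖ := by
    rw [integrable_fun_norm_addHaar, hdim]
    exact integrableOn_pow_smul_radialPart hn ht
  refine (hrad.const_mul C).mono' ?_ (Eventually.of_forall fun y => ?_)
  · exact ((measurable_cutTerm P t).comp (by fun_prop)).aestronglyMeasurable
  have hr0 : 0 ≤ radialPart d t ‖y‖ :=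
    Set.indicator_nonneg (fun r hr => Real.rpow_nonneg (le_trans zero_le_one hr) _) _
  rcases eq_or_ne y 0 with rfl | hy
  · have : cutTerm P t (fun i => (0 : EuclideanSpace ℝ (Fin n)) i) = 0 := cutTerm_zero P t
    rw [this, norm_zero]
    positivity
  · rw [cutTerm_ofLp_eq hP t ⟨y, hy⟩, norm_mul, Complex.norm_real,
      homeomorphUnitSphereProd_apply_snd_coe, Real.norm_of_nonneg hr0]
    gcongr
    refine (hCle _).trans (mul_le_of_le_one_right hC ?_)
    exact pow_le_one₀ (norm_nonneg _) (norm_ofLp_le_one _)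

lemma integrable_cutTerm {n d : ℕ} {P : MvPolynomial (Fin n) ℂ}
    (hP : P.IsHomogeneous d) (hn : 0 < n) {t : ℝ} (ht : (d + n : ℝ) < t) :
    Integrable (cutTerm P t) :=
  ((PiLp.volume_preserving_ofLp (Fin n)).integrable_comp_emb
    (MeasurableEquiv.toLp 2 (Fin n → ℝ)).symm.measurableEmbedding).1
      (integrable_cutTerm_euclidean hP hn ht)

lemma integral_cutTerm {n d : ℕ} {P : MvPolynomial (Fin n) ℂ} (hP : P.IsHomogeneous d)
    (hn : 0 < n) {t : ℝ} (ht : (d + n : ℝ) < t) :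
    ∫ x : Fin n → ℝ, cutTerm P t x = sphereIntegral P / ((t : ℂ) - ((d + n : ℝ) : ℂ)) := by
  rw [← integral_cutTerm_euclidean hP hn ht]
  exact ((PiLp.volume_preserving_ofLp (Fin n)).integral_comp
    (MeasurableEquiv.toLp 2 (Fin n → ℝ)).symm.measurableEmbedding (cutTerm P t)).symm

/-! ### Comparison of the sum with the integral -/

/-- The half-open unit cube of the points of `ℝⁿ` with integer part `k`. -/
def unitCube {n : ℕ} (k : Fin n → ℤ) : Set (Fin n → ℝ) :=
  Set.univ.pi fun i => Set.Ico (k i : ℝ) (k i + 1)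

lemma floor_eq_of_mem_unitCube {n : ℕ} {k : Fin n → ℤ} {x : Fin n → ℝ} (hx : x ∈ unitCube k) :
    (fun i => ⌊x i⌋) = k :=
  funext fun i => Int.floor_eq_iff.2 (hx i (Set.mem_univ i))

lemma measurableSet_unitCube {n : ℕ} (k : Fin n → ℤ) : MeasurableSet (unitCube k) :=
  MeasurableSet.univ_pi fun _ => measurableSet_Ico

lemma volume_unitCube {n : ℕ} (k : Fin n → ℤ) : volume (unitCube k) = 1 := by
  rw [unitCube, Real.volume_pi_Ico]
  simp

lemma iUnion_unitCube (n : ℕ) : ⋃ k : Fin n → ℤ, unitCube k = Set.univ :=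
  Set.eq_univ_of_forall fun x => Set.mem_iUnion.2
    ⟨fun i => ⌊x i⌋, fun _ _ => ⟨Int.floor_le _, Int.lt_floor_add_one _⟩⟩

lemma pairwise_disjoint_unitCube {n : ℕ} :
    Pairwise (Function.onFun Disjoint (unitCube (n := n))) := fun _ _ hkl =>
  Set.disjoint_left.2 fun _ hk hl =>
    hkl ((floor_eq_of_mem_unitCube hk).symm.trans (floor_eq_of_mem_unitCube hl))

lemma norm_toReal_sub_le_of_mem_unitCube {n : ℕ} {k : Fin n → ℤ} {x : Fin n → ℝ}
    (hx : x ∈ unitCube k) : ‖toReal k - x‖ ≤ 1 := by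
  rw [pi_norm_le_iff_of_nonneg zero_le_one]
  intro i
  have h := hx i (Set.mem_univ i)
  rw [Pi.sub_apply, toReal, Real.norm_eq_abs, abs_le]
  constructor <;> linarith [h.1, h.2]

lemma exists_norm_cutTerm_le {n d : ℕ} {P : MvPolynomial (Fin n) ℂ} (hP : P.IsHomogeneous d) :
    ∃ C : ℝ, 0 ≤ C ∧ ∀ t : ℝ, 0 ≤ t → ∀ x : Fin n → ℝ, ‖cutTerm P t x‖ ≤ C * ‖x‖ ^ d := by
  obtain ⟨C, hC, hCle⟩ := exists_norm_eval_le hP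
  refine ⟨C, hC, fun t ht x => ?_⟩
  rw [cutTerm]
  split_ifs with h
  · rw [norm_mul, Complex.norm_cpow_eq_rpow_re_of_pos (by linarith)]
    have hre : (-(t : ℂ) / 2).re = -t / 2 := by simp
    rw [hre]
    have h1 : (∑ i, x i ^ 2) ^ (-t / 2) ≤ 1 := Real.rpow_le_one_of_one_le_of_nonpos h (by linarith)
    have h2 : ‖fun i => (x i : ℂ)‖ ≤ ‖x‖ := by
      rw [pi_norm_le_iff_of_nonneg (norm_nonneg _)]
      intro i
      rw [Complex.norm_real]
      exact norm_le_pi_norm x i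
    refine (mul_le_of_le_one_right (norm_nonneg _) h1).trans ((hCle _).trans ?_)
    gcongr
  · rw [norm_zero]
    positivity

/-- On the cube at `k` the summand differs from its value at `k` by `O(|k| ^ (-n - 1))`, uniformly
for real parameters up to the abscissa `d + n`, since one difference gains one power of `|k|`. -/
lemma exists_summable_norm_cutTerm_sub_le {n d : ℕ} {P : MvPolynomial (Fin n) ℂ}
    (hP : P.IsHomogeneous d) :
    ∃ u : (Fin n → ℤ) → ℝ, Summable u ∧ ∀ t : ℝ, (d + n : ℝ) < t → t ≤ d + n + 1 →
      ∀ k, ∀ x ∈ unitCube k, ‖cutTerm P t (toReal k) - cutTerm P t x‖ ≤ u k := by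
  obtain ⟨C, R, hC, hR, hCR⟩ := exists_norm_fwdDiff_iter_cutTerm_le hP 1 (d + n + 1)
  obtain ⟨D, hD, hDle⟩ := exists_norm_cutTerm_le hP
  set A := D * (R + 2) ^ d + D * (R + 2) ^ d with hA
  set p : ℝ := -(n : ℝ) - 1 with hp
  refine ⟨fun k => (C * 3 ^ (-p) + A * (R + 2) ^ (-p)) * (1 + ‖k‖) ^ p,
    (summable_one_add_norm_rpow (by linarith)).mul_left _, fun t ht ht' k x hx => ?_⟩
  have hn0 : (0 : ℝ) ≤ n := Nat.cast_nonneg n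
  have hd0 : (0 : ℝ) ≤ d := Nat.cast_nonneg d
  have hv := norm_toReal_sub_le_of_mem_unitCube hx
  have hk0 := norm_nonneg k
  have h1 : ‖k‖ ≤ ‖x‖ + 1 := by
    have := norm_add_le (toReal k - x) x
    rw [sub_add_cancel, norm_toReal] at this
    linarith
  have h2 : ‖x‖ ≤ ‖k‖ + 1 := by
    have := norm_sub_le (toReal k) (toReal k - x)
    rw [sub_sub_cancel, norm_toReal] at this
    linarith
  change _ ≤ (C * 3 ^ (-p) + A * (R + 2) ^ (-p)) * (1 + ‖k‖) ^ p
  rcases le_or_gt (R + 1) ‖k‖ with hk | hk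
  · have hxR : R ≤ ‖x‖ := by linarith
    have hs : ‖(t : ℂ)‖ ≤ d + n + 1 := by
      rw [Complex.norm_real, Real.norm_of_nonneg (by linarith)]
      exact ht'
    have h3 := hCR t hs x (toReal k - x) hv hxR
    rw [Function.iterate_one, fwdDiff, add_sub_cancel, Complex.ofReal_re, Nat.cast_one] at h3
    refine h3.trans ?_
    have h4 : ‖x‖ ^ ((d : ℝ) - 1 - t) ≤ ‖x‖ ^ p :=
      Real.rpow_le_rpow_of_exponent_le (hR.trans hxR) (by linarith)
    have h5 : ‖x‖ ^ p ≤ ((1 + ‖k‖) / 3) ^ p :=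
      Real.rpow_le_rpow_of_nonpos (by positivity) (by linarith) (by linarith)
    have h6 : ((1 + ‖k‖) / 3) ^ p = 3 ^ (-p) * (1 + ‖k‖) ^ p := by
      rw [Real.div_rpow (by positivity) (by norm_num), Real.rpow_neg (by norm_num)]
      ring
    calc C * ‖x‖ ^ ((d : ℝ) - 1 - t) ≤ C * (3 ^ (-p) * (1 + ‖k‖) ^ p) := by
          rw [← h6]
          exact mul_le_mul_of_nonneg_left (h4.trans h5) hC
      _ ≤ _ := by
          rw [add_mul, mul_assoc]
          have : 0 ≤ A * (R + 2) ^ (-p) * (1 + ‖k‖) ^ p := by positivity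
          linarith
  · -- near the origin a bound uniform in `t` suffices
    have h3 : ‖cutTerm P t (toReal k) - cutTerm P t x‖ ≤ A := by
      refine (norm_sub_le _ _).trans (add_le_add ?_ ?_)
      · refine (hDle t (by linarith) _).trans ?_
        rw [norm_toReal]
        gcongr
        linarith
      · refine (hDle t (by linarith) _).trans ?_
        gcongr
        linarith
    have h4 : 1 ≤ (R + 2) ^ (-p) * (1 + ‖k‖) ^ p := by
      rw [Real.rpow_neg (by positivity), inv_mul_eq_div, one_le_div (by positivity)]
      exact Real.rpow_le_rpow_of_nonpos (by positivity) (by linarith) (by linarith)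
    calc ‖cutTerm P t (toReal k) - cutTerm P t x‖ ≤ A * ((R + 2) ^ (-p) * (1 + ‖k‖) ^ p) :=
          h3.trans (le_mul_of_one_le_right (by positivity) h4)
      _ ≤ _ := by
          rw [add_mul (C * 3 ^ (-p)), mul_assoc A]
          have : 0 ≤ C * 3 ^ (-p) * (1 + ‖k‖) ^ p := by positivity
          linarith

lemma twistedSum_zero_eq_tsum {n : ℕ} (P : MvPolynomial (Fin n) ℂ) (s : ℂ) :
    twistedSum P 0 s = ∑' k : Fin n → ℤ, cutTerm P s (toReal k) := by
  rw [twistedSum_eq_tsum]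
  exact tsum_congr fun k => by simp [char]

lemma exists_norm_twistedSum_zero_sub_le {n d : ℕ} {P : MvPolynomial (Fin n) ℂ}
    (hP : P.IsHomogeneous d) (hn : 0 < n) :
    ∃ K : ℝ, ∀ t : ℝ, (d + n : ℝ) < t → t ≤ d + n + 1 →
      ‖twistedSum P 0 t - sphereIntegral P / ((t : ℂ) - ((d + n : ℝ) : ℂ))‖ ≤ K := by
  obtain ⟨u, hu, hle⟩ := exists_summable_norm_cutTerm_sub_le hP
  refine ⟨∑' k, u k, fun t ht ht' => ?_⟩
  have hint := integrable_cutTerm hP hn ht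
  have h1 : HasSum (fun k : Fin n → ℤ => ∫ x in unitCube k, cutTerm P t x)
      (sphereIntegral P / ((t : ℂ) - ((d + n : ℝ) : ℂ))) := by
    have := hasSum_integral_iUnion measurableSet_unitCube pairwise_disjoint_unitCube
      (hint.integrableOn (s := ⋃ k : Fin n → ℤ, unitCube k))
    rwa [iUnion_unitCube, setIntegral_univ, integral_cutTerm hP hn ht] at this
  have h2 : HasSum (fun k : Fin n → ℤ => cutTerm P t (toReal k)) (twistedSum P 0 t) := by
    rw [twistedSum_zero_eq_tsum]
    exact (summable_cutTerm hP (by simpa using ht)).of_norm.hasSum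
  rw [← (h2.sub h1).tsum_eq]
  refine tsum_of_norm_bounded hu.hasSum fun k => ?_
  have hfin : volume (unitCube k) < ⊤ := by
    rw [volume_unitCube]
    exact ENNReal.one_lt_top
  have hreal : volume.real (unitCube k) = 1 := by
    rw [measureReal_def, volume_unitCube, ENNReal.toReal_one]
  have hconst : IntegrableOn (fun _ => cutTerm P t (toReal k)) (unitCube k) :=
    integrableOn_const hfin.ne
  have h3 : cutTerm P t (toReal k) - ∫ x in unitCube k, cutTerm P t x =
      ∫ x in unitCube k, (cutTerm P t (toReal k) - cutTerm P t x) := by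
    rw [integral_sub hconst hint.integrableOn, setIntegral_const, hreal,
      one_smul]
  rw [h3]
  have := norm_setIntegral_le_of_norm_le_const hfin (hle t ht ht' k)
  rwa [hreal, mul_one] at this

/-- The residue at `d + n` is read off from the comparison with the integral as the parameter
decreases to `d + n` along the reals. -/
lemma hasPolarForm_twistedSum_zero {n d : ℕ} {P : MvPolynomial (Fin n) ℂ}
    (hP : P.IsHomogeneous d) : HasPolarForm (d + n) (sphereIntegral P) (twistedSum P 0) := by
  rcases Nat.eq_zero_or_pos n with rfl | hn
  · -- in dimension `0` the sphere and the index set are both empty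
    have h1 : sphereIntegral P = 0 := by
      have : IsEmpty (sphere (0 : EuclideanSpace ℝ (Fin 0)) 1) := by
        refine ⟨fun u => ?_⟩
        have := norm_eq_of_mem_sphere u
        rw [Subsingleton.elim (u : EuclideanSpace ℝ (Fin 0)) 0, norm_zero] at this
        exact zero_ne_one this
      rw [sphereIntegral, integral_of_isEmpty]
    refine ⟨0, differentiable_const 0, fun s _ => ?_⟩
    have : IsEmpty {k : Fin 0 → ℤ // k ≠ 0} := ⟨fun k => k.2 (Subsingleton.elim _ _)⟩
    rw [h1, twistedSum, tsum_empty]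
    simp
  · obtain ⟨R, hR⟩ := exists_hasPolarForm_twistedSum_zero hP
    obtain ⟨K, hK⟩ := exists_norm_twistedSum_zero_sub_le hP hn
    rwa [← hR.eq_of_bounded hK]

/-! ### Schwartz sequences -/

lemma sq_norm_le_sum_sq_znorm {n q : ℕ} (l : Fin q → Fin n → ℤ) :
    ‖l‖ ^ 2 ≤ ∑ i, znorm (l i) ^ 2 := by
  have hz : ∀ i, ‖l i‖ ≤ znorm (l i) := fun i => by
    refine Real.le_sqrt_of_sq_le ?_
    rw [← norm_toReal]
    exact sq_norm_le_sum_sq (toReal (l i))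
  have h : ‖l‖ ≤ √(∑ i, znorm (l i) ^ 2) := by
    rw [pi_norm_le_iff_of_nonneg (Real.sqrt_nonneg _)]
    intro i
    refine (hz i).trans (Real.le_sqrt_of_sq_le ?_)
    exact Finset.single_le_sum (f := fun i => znorm (l i) ^ 2) (fun j _ => sq_nonneg _)
      (Finset.mem_univ i)
  calc ‖l‖ ^ 2 ≤ √(∑ i, znorm (l i) ^ 2) ^ 2 := by gcongr
    _ = _ := Real.sq_sqrt (by positivity)

lemma IsSchwartzSeq.exists_mul_le {n q : ℕ} {b : (Fin q → Fin n → ℤ) → ℂ} (hb : IsSchwartzSeq b)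
    (r : ℕ) : ∃ C : ℝ, 0 ≤ C ∧ ∀ l, (1 + ‖l‖) ^ r * ‖b l‖ ≤ C := by
  obtain ⟨C, hC⟩ := hb r
  refine ⟨√(2 ^ r * C), Real.sqrt_nonneg _, fun l => Real.le_sqrt_of_sq_le ?_⟩
  have h1 : (1 + ‖l‖) ^ 2 ≤ 2 * (1 + ∑ i, znorm (l i) ^ 2) := by
    nlinarith [sq_norm_le_sum_sq_znorm l, sq_nonneg (1 - ‖l‖)]
  calc ((1 + ‖l‖) ^ r * ‖b l‖) ^ 2 = ((1 + ‖l‖) ^ 2) ^ r * ‖b l‖ ^ 2 := by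
        rw [mul_pow, pow_right_comm]
    _ ≤ (2 * (1 + ∑ i, znorm (l i) ^ 2)) ^ r * ‖b l‖ ^ 2 := by gcongr
    _ = 2 ^ r * ((1 + ∑ i, znorm (l i) ^ 2) ^ r * ‖b l‖ ^ 2) := by rw [mul_pow]; ring
    _ ≤ 2 ^ r * C := by gcongr; exact hC l

lemma summable_inv_one_add_norm_pow (n q : ℕ) :
    Summable fun l : Fin q → Fin n → ℤ => ((1 + ‖l‖) ^ (q * n + 1))⁻¹ := by
  rcases Nat.eq_zero_or_pos q with rfl | hq
  · exact (hasSum_fintype _).summable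
  have hq' : (0 : ℝ) < q := by exact_mod_cast hq
  have hp : -((q * n + 1 : ℕ) : ℝ) / q < -n := by
    rw [div_lt_iff₀ hq']
    push_cast
    linarith
  have h := summable_pi_prod (g := fun k : Fin n → ℤ => (1 + ‖k‖) ^ (-((q * n + 1 : ℕ) : ℝ) / q))
    (fun k => by positivity) (summable_one_add_norm_rpow hp) q
  refine Summable.of_nonneg_of_le (fun l => by positivity) (fun l => ?_) h
  rw [← Real.rpow_natCast, ← Real.rpow_neg (by positivity)]
  exact one_add_norm_rpow_le_prod hq (neg_nonpos.2 (Nat.cast_nonneg _)) l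

lemma IsSchwartzSeq.summable_norm_mul {n q : ℕ} {b : (Fin q → Fin n → ℤ) → ℂ}
    (hb : IsSchwartzSeq b) (A : ℕ) : Summable fun l => ‖b l‖ * (1 + ‖l‖) ^ A := by
  obtain ⟨C, -, hC⟩ := hb.exists_mul_le (A + (q * n + 1))
  refine Summable.of_nonneg_of_le (fun l => by positivity) (fun l => ?_)
    ((summable_inv_one_add_norm_pow n q).mul_left C)
  rw [← div_eq_mul_inv, le_div_iff₀ (by positivity)]
  refine le_trans (le_of_eq ?_) (hC l)
  rw [pow_add]
  ring

lemma IsSchwartzSeq.summable {n q : ℕ} {b : (Fin q → Fin n → ℤ) → ℂ}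
    (hb : IsSchwartzSeq b) : Summable b :=
  Summable.of_norm (by simpa using hb.summable_norm_mul 0)

lemma norm_twistedSum_le {n d : ℕ} {P : MvPolynomial (Fin n) ℂ} (hP : P.IsHomogeneous d)
    (a : Fin n → ℝ) {s : ℂ} (hs : (d + n : ℝ) < s.re) :
    ‖twistedSum P a s‖ ≤ ∑' k : Fin n → ℤ, ‖cutTerm P s (toReal k)‖ := by
  rw [twistedSum_eq_tsum]
  refine tsum_of_norm_bounded (summable_cutTerm hP hs).hasSum fun k => ?_
  rw [norm_mul, norm_char, mul_one]

lemma summable_averagedTerm {n d q : ℕ} {P : MvPolynomial (Fin n) ℂ} (hP : P.IsHomogeneous d)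
    {b : (Fin q → Fin n → ℤ) → ℂ} (hb : IsSchwartzSeq b) (Θ : Matrix (Fin n) (Fin n) ℝ)
    (ε : Fin q → ℤ) {s : ℂ} (hs : (d + n : ℝ) < s.re) : Summable (averagedTerm P Θ ε b s) := by
  refine Summable.of_norm_bounded (hb.summable.norm.mul_right
    (∑' k : Fin n → ℤ, ‖cutTerm P s (toReal k)‖)) fun l => ?_
  rw [averagedTerm, norm_mul]
  gcongr
  exact norm_twistedSum_le hP _ hs

lemma summable_term {n d : ℕ} {P : MvPolynomial (Fin n) ℂ} (hP : P.IsHomogeneous d)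
    (a : Fin n → ℝ) {s : ℂ} (hs : (d + n : ℝ) < s.re) :
    Summable fun k : {k : Fin n → ℤ // k ≠ 0} => term P a s k :=
  ((summable_cutTerm_mul_char hP a hs).subtype {k | k ≠ 0}).congr
    fun k => (term_eq_cutTerm P a s k.2).symm

lemma twistedSum_of_mem_range {n : ℕ} (P : MvPolynomial (Fin n) ℂ) {a : Fin n → ℝ}
    (ha : a ∈ Set.range (toReal (n := n))) : twistedSum P a = twistedSum P 0 := by
  obtain ⟨m, rfl⟩ := ha
  ext s
  rw [twistedSum_zero_eq_tsum, twistedSum_eq_tsum]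
  refine tsum_congr fun k => ?_
  have h : char (toReal m) k = 1 := by
    rw [char, Complex.exp_eq_one_iff]
    refine ⟨∑ i, k i * m i, ?_⟩
    rw [dotProduct]
    simp only [toReal]
    push_cast
    ring
  rw [h, mul_one]

/-! ### Small divisors -/

lemma norm_combo_le {n q : ℕ} {ε : Fin q → ℤ} (hε : ∀ i, ε i ∈ ({-1, 0, 1} : Set ℤ))
    (l : Fin q → Fin n → ℤ) : ‖combo ε l‖ ≤ q * ‖l‖ := by
  rw [combo]
  refine (norm_sum_le _ _).trans ?_
  calc ∑ i, ‖ε i • l i‖ ≤ ∑ _i : Fin q, ‖l‖ := by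
        refine Finset.sum_le_sum fun i _ => ?_
        have h : ‖ε i • l i‖ ≤ ‖l i‖ := by
          rcases hε i with h | h | h
          · simp [h]
          · simp [h]
          · rw [Set.mem_singleton_iff] at h
            simp [h]
        exact h.trans (norm_le_pi_norm l i)
    _ = q * ‖l‖ := by simp

lemma znorm_le {n : ℕ} (m : Fin n → ℤ) : znorm m ≤ (n + 1) * (1 + ‖m‖) := by
  have hn : (0 : ℝ) ≤ n := Nat.cast_nonneg n
  have hm := norm_nonneg m
  refine Real.sqrt_le_iff.2 ⟨by positivity, ?_⟩
  have h := sum_sq_le (toReal m)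
  rw [norm_toReal] at h
  refine h.trans ?_
  have h1 : (n : ℝ) ≤ (n + 1) ^ 2 := by nlinarith
  have h2 : ‖m‖ ^ 2 ≤ (1 + ‖m‖) ^ 2 := by gcongr; linarith
  rw [mul_pow]
  gcongr

lemma dotProduct_transpose_mulVec {n : ℕ} (Θ : Matrix (Fin n) (Fin n) ℝ) (x u : Fin n → ℝ) :
    x ⬝ᵥ Θ.transpose.mulVec u = u ⬝ᵥ Θ.mulVec x := by
  rw [Matrix.mulVec_transpose, Matrix.dotProduct_mulVec, dotProduct_comm]

/-- For a badly approximable matrix, the vector `Θ m` has for each `m ≠ 0` a coordinate whose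
distance to the integers is at least a negative power of `|m|`: otherwise its combination
`u · Θ m = m · ᵗΘ u` would be too close to an integer. -/
lemma IsBadlyApproximableMatrix.exists_le_norm_kappa {n : ℕ} {Θ : Matrix (Fin n) (Fin n) ℝ}
    (hΘ : IsBadlyApproximableMatrix Θ) :
    ∃ (c : ℝ) (A : ℕ), 0 < c ∧ ∀ m : Fin n → ℤ, m ≠ 0 →
      ∃ i, c / (1 + ‖m‖) ^ A ≤ ‖kappa (Θ.mulVec (toReal m)) i‖ := by
  obtain ⟨u, δ, hδ, c, hc, h⟩ := hΘ
  set U : ℝ := ∑ i, |(u i : ℝ)| with hU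
  have hU0 : 0 ≤ U := Finset.sum_nonneg fun i _ => abs_nonneg _
  set A := ⌈δ⌉₊ with hA
  refine ⟨c / (U + 1) / (n + 1 : ℝ) ^ A, A, by positivity, fun m hm => ?_⟩
  by_contra! hsmall
  set a := Θ.mulVec (toReal m) with ha
  have h1 := h m hm (∑ i, u i * round (a i))
  rw [dotProduct_transpose_mulVec, ← ha] at h1
  have hdot : toReal u ⬝ᵥ a - ((∑ i, u i * round (a i) : ℤ) : ℝ) =
      ∑ i, (u i : ℝ) * (a i - round (a i)) := by
    rw [dotProduct]
    push_cast
    rw [← Finset.sum_sub_distrib]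
    exact Finset.sum_congr rfl fun i _ => by rw [toReal]; ring
  -- `τ` is the assumed upper bound for all coordinates, chosen so that `U τ` is below the lower
  -- bound for `u · Θ m`
  set τ := c / (U + 1) / (n + 1 : ℝ) ^ A / (1 + ‖m‖) ^ A with hτ
  have h2 : |∑ i, (u i : ℝ) * (a i - round (a i))| ≤ U * τ := by
    rw [hU, Finset.sum_mul]
    refine (Finset.abs_sum_le_sum_abs _ _).trans (Finset.sum_le_sum fun i _ => ?_)
    rw [abs_mul]
    gcongr
    have h3 := four_mul_abs_sub_round_le_norm_kappa a i
    have h4 := hsmall i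
    linarith [abs_nonneg (a i - round (a i))]
  have hz0 : 0 < znorm m :=
    Real.sqrt_pos.2 (lt_of_lt_of_le one_pos (one_le_sum_sq_toReal hm))
  have hbase : (1 : ℝ) ≤ (n + 1) * (1 + ‖m‖) := by
    have hn : (0 : ℝ) ≤ n := Nat.cast_nonneg n
    nlinarith [norm_nonneg m, mul_nonneg hn (norm_nonneg m)]
  have h5 : (((n + 1 : ℝ) ^ A) * (1 + ‖m‖) ^ A)⁻¹ ≤ znorm m ^ (-δ) := by
    calc (((n + 1 : ℝ) ^ A) * (1 + ‖m‖) ^ A)⁻¹ = ((n + 1 : ℝ) * (1 + ‖m‖)) ^ (-(A : ℝ)) := by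
          rw [Real.rpow_neg (by positivity), Real.rpow_natCast, mul_pow]
      _ ≤ ((n + 1 : ℝ) * (1 + ‖m‖)) ^ (-δ) :=
          Real.rpow_le_rpow_of_exponent_le hbase (neg_le_neg (Nat.le_ceil δ))
      _ ≤ znorm m ^ (-δ) :=
          Real.rpow_le_rpow_of_nonpos hz0 (znorm_le m) (by linarith)
  have h6 : (U + 1) * τ ≤ c * znorm m ^ (-δ) := by
    calc (U + 1) * τ = c * (((n + 1 : ℝ) ^ A) * (1 + ‖m‖) ^ A)⁻¹ := by
          rw [hτ]
          field_simp
      _ ≤ _ := by gcongr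
  have hτ0 : 0 < τ := by positivity
  rw [hdot] at h1
  linarith

/-- Off the resonant set, the bounds for the continuations of the summands grow polynomially in `l`,
locally uniformly in `s`, so that the decay of `b` makes their sum converge to an entire function. -/
lemma extendsToEntire_offResonantSum {n d q : ℕ} {P : MvPolynomial (Fin n) ℂ}
    (hP : P.IsHomogeneous d) {b : (Fin q → Fin n → ℤ) → ℂ} (hb : IsSchwartzSeq b)
    {Θ : Matrix (Fin n) (Fin n) ℝ} (hΘ : IsBadlyApproximableMatrix Θ) {ε : Fin q → ℤ}
    (hε : ∀ i, ε i ∈ ({-1, 0, 1} : Set ℤ)) :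
    ExtendsToEntire (d + n) (offResonantSum P Θ ε b) := by
  obtain ⟨c, A, hc, hcA⟩ := hΘ.exists_le_norm_kappa
  choose i hi using fun l : ((resonantSet ε)ᶜ : Set (Fin q → Fin n → ℤ)) => hcA (combo ε l) l.2
  have hκ : ∀ l, kappa (Θ.mulVec (toReal (combo ε l.1))) (i l) ≠ 0 := fun l =>
    norm_pos_iff.1 (lt_of_lt_of_le (by positivity) (hi l))
  refine ⟨fun s => ∑' l : ((resonantSet ε)ᶜ : Set (Fin q → Fin n → ℤ)),
    b l * contSum d P (i l) (Θ.mulVec (toReal (combo ε l))) s, fun s => ?_, fun s hs => ?_⟩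
  · obtain ⟨C, N, hC, hCle⟩ := exists_norm_contSum_le hP (‖s‖ + 1)
    have hs : ball (0 : ℂ) (‖s‖ + 1) ∈ 𝓝 s := isOpen_ball.mem_nhds (by simp)
    have hu : Summable fun l : ((resonantSet ε)ᶜ : Set (Fin q → Fin n → ℤ)) =>
        C * ((q + 1 : ℝ) ^ A / c) ^ N * (‖b l‖ * (1 + ‖(l : Fin q → Fin n → ℤ)‖) ^ (A * N)) :=
      ((hb.summable_norm_mul (A * N)).subtype _).mul_left _
    refine DifferentiableOn.differentiableAt ?_ hs
    refine Complex.differentiableOn_tsum_of_summable_norm hu (fun l => ?_) isOpen_ball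
      fun l z hz => ?_
    · exact ((differentiable_contSum hP (hκ l)).const_mul _).differentiableOn
    · have h1 := hCle (i l) _ (hκ l) z (mem_ball_zero_iff.1 hz).le
      have h2 : 1 + ‖combo ε l.1‖ ≤ (q + 1) * (1 + ‖l.1‖) := by
        have h3 := norm_combo_le hε l.1
        nlinarith [norm_nonneg l.1, (Nat.cast_nonneg q : (0 : ℝ) ≤ q)]
      have h4 : (‖kappa (Θ.mulVec (toReal (combo ε l.1))) (i l)‖)⁻¹ ≤
          (q + 1 : ℝ) ^ A / c * (1 + ‖l.1‖) ^ A := by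
        calc (‖kappa (Θ.mulVec (toReal (combo ε l.1))) (i l)‖)⁻¹
            ≤ (c / (1 + ‖combo ε l.1‖) ^ A)⁻¹ := inv_anti₀ (by positivity) (hi l)
          _ = (1 + ‖combo ε l.1‖) ^ A / c := inv_div _ _
          _ ≤ ((q + 1) * (1 + ‖l.1‖)) ^ A / c := by gcongr
          _ = _ := by rw [mul_pow]; ring
      rw [norm_mul]
      calc ‖b l‖ * ‖contSum d P (i l) (Θ.mulVec (toReal (combo ε l.1))) z‖
          ≤ ‖b l‖ * (C * ((q + 1 : ℝ) ^ A / c * (1 + ‖l.1‖) ^ A) ^ N) := by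
            gcongr
            refine h1.trans ?_
            rw [div_eq_mul_inv, ← inv_pow]
            gcongr
        _ = _ := by rw [mul_pow, ← pow_mul]; ring
  · rw [offResonantSum]
    exact tsum_congr fun l => by rw [averagedTerm, contSum_eq_twistedSum hP (hκ l) hs]

lemma averagedSum_eq {n d q : ℕ} {P : MvPolynomial (Fin n) ℂ} (hP : P.IsHomogeneous d)
    {b : (Fin q → Fin n → ℤ) → ℂ} (hb : IsSchwartzSeq b) (Θ : Matrix (Fin n) (Fin n) ℝ)
    (ε : Fin q → ℤ) {s : ℂ} (hs : (d + n : ℝ) < s.re) :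
    averagedSum P Θ ε b s =
      resonantSum ε b * twistedSum P 0 s + offResonantSum P Θ ε b s := by
  rw [averagedSum, ← (summable_averagedTerm hP hb Θ ε hs).tsum_subtype_add_tsum_subtype_compl
    (resonantSet ε), resonantSum, ← tsum_mul_right, offResonantSum]
  congr 1
  refine tsum_congr fun l => ?_
  have h : combo ε l.1 = 0 := l.2
  rw [averagedTerm, h, toReal_zero, Matrix.mulVec_zero]

lemma hasPolarForm_averagedSum {n d q : ℕ} {P : MvPolynomial (Fin n) ℂ}
    (hP : P.IsHomogeneous d) {b : (Fin q → Fin n → ℤ) → ℂ} (hb : IsSchwartzSeq b)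
    {Θ : Matrix (Fin n) (Fin n) ℝ} (hΘ : IsBadlyApproximableMatrix Θ) {ε : Fin q → ℤ}
    (hε : ∀ i, ε i ∈ ({-1, 0, 1} : Set ℤ)) :
    HasPolarForm (d + n) (resonantSum ε b * sphereIntegral P) (averagedSum P Θ ε b) := by
  obtain ⟨E, hE, hf⟩ := hasPolarForm_twistedSum_zero hP
  obtain ⟨G, hG, hg⟩ := extendsToEntire_offResonantSum hP hb hΘ hε
  refine ⟨fun s => resonantSum ε b * E s + G s, (hE.const_mul _).add hG, fun s hs => ?_⟩
  rw [averagedSum_eq hP hb Θ ε hs, hf s hs, ← hg s hs]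
  ring

end TwistedSeries

theorem mainTheorem3 {n d q : ℕ} (P : MvPolynomial (Fin n) ℂ) (hP : P.IsHomogeneous d)
    (b : (Fin q → Fin n → ℤ) → ℂ) (hb : TwistedSeries.IsSchwartzSeq b) :
    -- absolute convergence of all the series involved, for `Re s > d + n`
    ((∀ (a : Fin n → ℝ) (s : ℂ), (d + n : ℝ) < s.re →
        Summable (fun k : {k : Fin n → ℤ // k ≠ 0} => TwistedSeries.term P a s k)) ∧
      Summable b ∧
      (∀ (Θ : Matrix (Fin n) (Fin n) ℝ) (ε : Fin q → ℤ), (∀ i, ε i ∈ ({-1, 0, 1} : Set ℤ)) →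
        ∀ s : ℂ, (d + n : ℝ) < s.re → Summable (TwistedSeries.averagedTerm P Θ ε b s))) ∧
    -- (i) 1
    (∀ a : Fin n → ℝ, a ∈ Set.range (TwistedSeries.toReal (n := n)) →
      (∃ F : ℂ → ℂ,
        TwistedSeries.IsMeromorphicContinuation (d + n) (TwistedSeries.twistedSum P a) F ∧
        (∀ z : ℂ, z ≠ d + n → AnalyticAt ℂ F z) ∧
        (TwistedSeries.sphereIntegral P ≠ 0 →
          TwistedSeries.HasSimplePoleWithResidue F (d + n) (TwistedSeries.sphereIntegral P))) ∧
      (¬ TwistedSeries.ExtendsToEntire (d + n) (TwistedSeries.twistedSum P a) ↔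
        TwistedSeries.sphereIntegral P ≠ 0)) ∧
    -- (i) 2
    (∀ a : Fin n → ℝ, a ∉ Set.range (TwistedSeries.toReal (n := n)) →
      TwistedSeries.ExtendsToEntire (d + n) (TwistedSeries.twistedSum P a)) ∧
    -- (ii)
    (∀ Θ : Matrix (Fin n) (Fin n) ℝ, TwistedSeries.IsBadlyApproximableMatrix Θ →
      ∀ ε : Fin q → ℤ, (∀ i, ε i ∈ ({-1, 0, 1} : Set ℤ)) →
      (∃ F : ℂ → ℂ,
        TwistedSeries.IsMeromorphicContinuation (d + n)
          (TwistedSeries.averagedSum P Θ ε b) F ∧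
        (∀ z : ℂ, z ≠ d + n → AnalyticAt ℂ F z) ∧
        (TwistedSeries.resonantSum ε b * TwistedSeries.sphereIntegral P ≠ 0 →
          TwistedSeries.HasSimplePoleWithResidue F (d + n)
            (TwistedSeries.resonantSum ε b * TwistedSeries.sphereIntegral P))) ∧
      (TwistedSeries.resonantSum ε b * TwistedSeries.sphereIntegral P = 0 →
        TwistedSeries.ExtendsToEntire (d + n) (TwistedSeries.averagedSum P Θ ε b))) ∧
    -- (iii)
    (∀ Θ : Matrix (Fin n) (Fin n) ℝ, TwistedSeries.IsBadlyApproximableMatrix Θ →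
      ∀ ε : Fin q → ℤ, (∀ i, ε i ∈ ({-1, 0, 1} : Set ℤ)) →
      TwistedSeries.ExtendsToEntire (d + n) (TwistedSeries.offResonantSum P Θ ε b)) := by
  have hcast : (((d + n : ℝ)) : ℂ) = (d : ℂ) + n := by push_cast; rfl
  refine ⟨⟨fun a s hs => TwistedSeries.summable_term hP a hs, hb.summable,
    fun Θ ε _ s hs => TwistedSeries.summable_averagedTerm hP hb Θ ε hs⟩, fun a ha => ?_,
    fun a ha => TwistedSeries.extendsToEntire_twistedSum hP ha, fun Θ hΘ ε hε => ?_,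
    fun Θ hΘ ε hε => TwistedSeries.extendsToEntire_offResonantSum hP hb hΘ hε⟩
  · rw [TwistedSeries.twistedSum_of_mem_range P ha]
    have h := TwistedSeries.hasPolarForm_twistedSum_zero hP
    refine ⟨?_, fun hne h0 => hne ?_, fun hne hext => hne (h.unique hext.hasPolarForm)⟩
    · rw [← hcast]
      exact h.exists_continuation
    · rw [h0] at h
      exact h.extendsToEntire
  · have h := TwistedSeries.hasPolarForm_averagedSum hP hb hΘ hε
    refine ⟨?_, fun h0 => ?_⟩
    · rw [← hcast]
      exact h.exists_continuation
    · rw [h0] at h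
      exact h.extendsToEntire
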